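/- Conventions. A \emph{Waldhausen category} is a category $\mathcal C$ with a distinguished zero object $*$, a subcategory of w-cofibrations and a subcategory of weak equivalences, such that: isomorphisms are w-cofibrations and weak equivalences; every $*\to A$ is a w-cofibration; pushouts along w-cofibrations exist and the cobase change of a w-cofibration is a w-cofibration; and the gluing lemma holds (a map of spans $B\leftarrow A\to X$, each having a w-cofibration $A\to B$, which is a weak equivalence on the three objects induces a weak equivalence of pushouts). It is \emph{saturated} if its weak equivalences satisfy two-out-of-three. A functor between Waldhausen categories is \emph{exact} if it preserves zero objects, weak equivalences, w-cofibrations, and pushouts along w-cofibrations. A map is a \emph{weak w-cofibration} if it is connected to a w-cofibration by a zigzag of weak equivalences in the category of arrows $\mathrm{Ar}\,\mathcal C$ (maps of arrows that are weak equivalences at both ends). $\mathcal C$ \emph{admits functorial factorization of weak w-cofibrations} (FFWC) if weak w-cofibrations $f\colon A\to B$ can be factored, functorially in $f$ in $\mathrm{Ar}\,\mathcal C$, as a w-cofibration $A\to Tf$ followed by a weak equivalence $Tf\to B$. A commutative square is \emph{homotopy cocartesian} if it is connected by a zigzag of objectwise weak equivalences of squares to a pushout square in which one of the two sets of parallel arrows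 consists of w-cofibrations. Let $\mathrm{Ar}[n]$ be the poset of pairs $(i,j)$, $0\le i\le j\le n$, with $(i,j)\le(i',j')$ iff $i\le i'$ and $j\le j'$. $S_n\mathcal C$ is the full subcategory of functors $A\colon\mathrm{Ar}[n]\to\mathcal C$ with $A_{i,i}=*$ for all $i$ and, for all $i\le j\le k$, $A_{i,j}\to A_{i,k}$ a w-cofibration and the square $(A_{i,j},A_{i,k},A_{j,j},A_{j,k})$ a pushout. $S'_n\mathcal C$ is the full subcategory of functors $A$ such that $*\to A_{i,i}$ is a weak equivalence for all $i$ and, for all $i\le j\le k$, $A_{i,j}\to A_{i,k}$ is a weak w-cofibration and the square $(A_{i,j},A_{i,k},A_{j,j},A_{j,k})$ is homotopy cocartesian. In both, weak equivalences are objectwise. A map $A\to B$ is a w-cofibration when each $A_{i,j}\to B_{i,j}$ is a w-cofibration in $\mathcal C$ and each induced map $A_{i,k}\cup_{A_{i,j}}B_{i,j}\to B_{i,k}$ is a w-cofibration in the case of $S_n\mathcal C$, respectively a weak w-cofibration in the case of $S'_n\mathcal C$. Monotone maps $[m]\to[n]$ act by precomposition. Write $w_\bullet X_\bullet$ for the bisimplicial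 set which in degree $n$ is the nerve of the category of weak equivalences of $X_n$; a map of bisimplicial sets is a weak equivalence if the map of diagonals (equivalently, of geometric realizations) is a weak equivalence of simplicial sets, i.e. induces a bijection on homotopy classes of maps into every Kan complex. Theorem. Let $\mathcal C$ be a (small) saturated Waldhausen category that admits FFWC. Then $S_\bullet\mathcal C$ and $S'_\bullet\mathcal C$ are simplicial Waldhausen categories (each term is a Waldhausen category and all simplicial structure functors are exact), the inclusion $S_\bullet\mathcal C\to S'_\bullet\mathcal C$ is an exact simplicial functor, and the induced map of bisimplicial sets $w_\bullet S_\bullet\mathcal C\to w_\bullet S'_\bullet\mathcal C$ is a weak equivalence. -/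

import Mathlib

open CategoryTheory CategoryTheory.Limits Opposite

universe w v u v₁ u₁ v₂ u₂

namespace WaldhausenK

/-! ### Waldhausen categories -/

/-- The data carried by a Waldhausen category: a distinguished object `pt` (written `*`), a class
`cof` of morphisms (the w-cofibrations) and a class `weq` of morphisms (the weak equivalences)
which contains the identities and is closed under composition.  The remaining axioms are in
`PreWaldhausen.IsWaldhausen`. -/
structure PreWaldhausen (C : Type u) [Category.{v} C] where
  /-- the distinguished zero object -/
  pt : C
  /-- the w-cofibrations -/
  cof : MorphismProperty C
  /-- the weak equivalences -/
  weq : MorphismProperty C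
  weq_mult : weq.IsMultiplicative

attribute [instance] PreWaldhausen.weq_mult

/-- The relation "`X` and `Y` are connected by a finite zigzag of morphisms which satisfy `P`". -/
def Zigzag {D : Type u} [Category.{v} D] (P : MorphismProperty D) : D → D → Prop :=
  Relation.EqvGen fun X Y => ∃ f : X ⟶ Y, P f

namespace PreWaldhausen

variable {C : Type u} [Category.{v} C] (W : PreWaldhausen C)

/-- Waldhausen's axioms for a category with w-cofibrations and weak equivalences. -/
class IsWaldhausen : Prop where
  isZero_pt : IsZero W.pt
  cof_comp : ∀ {X Y Z : C} (f : X ⟶ Y) (g : Y ⟶ Z), W.cof f → W.cof g → W.cof (f ≫ g)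
  cof_of_isIso : ∀ {X Y : C} (f : X ⟶ Y), IsIso f → W.cof f
  cof_from_pt : ∀ {X : C} (f : W.pt ⟶ X), W.cof f
  hasPushout : ∀ {A B X : C} (f : A ⟶ B) (g : A ⟶ X), W.cof f → HasPushout f g
  cof_cobaseChange : ∀ {A B X P : C} {f : A ⟶ B} {g : A ⟶ X} {inl : B ⟶ P} {inr : X ⟶ P},
    IsPushout f g inl inr → W.cof f → W.cof inr
  weq_of_isIso : ∀ {X Y : C} (f : X ⟶ Y), IsIso f → W.weq f
  gluing : ∀ {A B X P A' B' X' P' : C}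
    {f : A ⟶ B} {g : A ⟶ X} {inl : B ⟶ P} {inr : X ⟶ P}
    {f' : A' ⟶ B'} {g' : A' ⟶ X'} {inl' : B' ⟶ P'} {inr' : X' ⟶ P'}
    (a : A ⟶ A') (b : B ⟶ B') (x : X ⟶ X') (p : P ⟶ P'),
    IsPushout f g inl inr → IsPushout f' g' inl' inr' → W.cof f → W.cof f' →
    f ≫ b = a ≫ f' → g ≫ x = a ≫ g' → inl ≫ p = b ≫ inl' → inr ≫ p = x ≫ inr' →
    W.weq a → W.weq b → W.weq x → W.weq p

/-- A Waldhausen category is saturated when its weak equivalences satisfy two-out-of-three. -/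
def IsSaturated : Prop := W.weq.HasTwoOutOfThreeProperty

/-- Weak equivalences in the category of arrows. -/
def arrowWeq : MorphismProperty (Arrow C) :=
  fun _ _ φ => W.weq φ.left ∧ W.weq φ.right

/-- A weak w-cofibration is a morphism which is weakly equivalent, by a zigzag in the category of
arrows, to a w-cofibration. -/
def weakCof : MorphismProperty C :=
  fun _ _ f => ∃ g : Arrow C, W.cof g.hom ∧ Zigzag W.arrowWeq (Arrow.mk f) g

/-- The weak w-cofibrations as objects of the category of arrows. -/
def weakCofArrow : ObjectProperty (Arrow C) := fun f => W.weakCof f.hom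

/-- Functorial factorization of weak w-cofibrations: a functor `T` on the full subcategory of
the category of arrows given by the weak w-cofibrations, and natural factorizations
`A ⟶ T f ⟶ B` of the weak w-cofibrations `f : A ⟶ B` as a w-cofibration followed by a weak
equivalence. -/
def FFWC : Prop :=
  ∃ (T : W.weakCofArrow.FullSubcategory ⥤ C)
    (i : W.weakCofArrow.ι ⋙ Arrow.leftFunc ⟶ T)
    (p : T ⟶ W.weakCofArrow.ι ⋙ Arrow.rightFunc),
    ∀ f, i.app f ≫ p.app f = f.obj.hom ∧ W.cof (i.app f) ∧ W.weq (p.app f)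

/-- Weak equivalences in the category of commutative squares. -/
def squareWeq : MorphismProperty (Square C) :=
  fun _ _ φ => W.weq φ.τ₁ ∧ W.weq φ.τ₂ ∧ W.weq φ.τ₃ ∧ W.weq φ.τ₄

/-- A commutative square is homotopy cocartesian when it is weakly equivalent, by a zigzag of
squares, to a pushout square in which one of the two sets of parallel arrows consists of
w-cofibrations. -/
def IsHomotopyCocartesian (sq : Square C) : Prop :=
  ∃ sq' : Square C, sq'.IsPushout ∧
    ((W.cof sq'.f₁₂ ∧ W.cof sq'.f₃₄) ∨ (W.cof sq'.f₁₃ ∧ W.cof sq'.f₂₄)) ∧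
    Zigzag W.squareWeq sq sq'

end PreWaldhausen

/-- Exact functors: they preserve the zero object, weak equivalences, w-cofibrations, and
pushouts along w-cofibrations. -/
structure IsExactFunctor {D : Type u₁} [Category.{v₁} D] {E : Type u₂} [Category.{v₂} E]
    (W : PreWaldhausen D) (W' : PreWaldhausen E) (F : D ⥤ E) : Prop where
  map_pt : IsZero (F.obj W.pt)
  map_weq : ∀ {X Y : D} (f : X ⟶ Y), W.weq f → W'.weq (F.map f)
  map_cof : ∀ {X Y : D} (f : X ⟶ Y), W.cof f → W'.cof (F.map f)
  map_isPushout : ∀ {A B X P : D} {f : A ⟶ B} {g : A ⟶ X} {inl : B ⟶ P} {inr : X ⟶ P},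
    IsPushout f g inl inr → W.cof f →
      IsPushout (F.map f) (F.map g) (F.map inl) (F.map inr)

/-! ### Simplicial Waldhausen categories and nerves of weak equivalences -/

set_option linter.checkUnivs false in
/-- A simplicial category, each of whose terms carries the data of a Waldhausen category, and
whose structure functors preserve the weak equivalences. -/
structure SimplicialPreWaldhausen where
  /-- the underlying simplicial category -/
  cat : SimplicialObject Cat.{v, u}
  /-- the zero objects, w-cofibrations and weak equivalences -/
  wald (n : SimplexCategoryᵒᵖ) : PreWaldhausen (cat.obj n)
  map_weq {m n : SimplexCategoryᵒᵖ} (α : m ⟶ n) {X Y : cat.obj m} (f : X ⟶ Y) :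
    (wald m).weq f → (wald n).weq ((cat.map α).toFunctor.map f)

namespace SimplicialPreWaldhausen

/-- A simplicial Waldhausen category: every term is a Waldhausen category and all simplicial
structure functors are exact. -/
structure IsSimplicialWaldhausen (X : SimplicialPreWaldhausen.{v, u}) : Prop where
  isWaldhausen (n : SimplexCategoryᵒᵖ) : (X.wald n).IsWaldhausen
  isExact {m n : SimplexCategoryᵒᵖ} (α : m ⟶ n) :
    IsExactFunctor (X.wald m) (X.wald n) (X.cat.map α).toFunctor

/-- A simplicial functor which preserves the weak equivalences. -/
structure Hom (X Y : SimplicialPreWaldhausen.{v, u}) where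
  /-- the underlying simplicial functor -/
  hom : X.cat ⟶ Y.cat
  map_weq (n : SimplexCategoryᵒᵖ) {A B : X.cat.obj n} (f : A ⟶ B) :
    (X.wald n).weq f → (Y.wald n).weq ((hom.app n).toFunctor.map f)

/-- A simplicial functor is exact when it is an exact functor in each simplicial degree. -/
def Hom.IsExact {X Y : SimplicialPreWaldhausen.{v, u}} (F : X.Hom Y) : Prop :=
  ∀ n : SimplexCategoryᵒᵖ, IsExactFunctor (X.wald n) (Y.wald n) (F.hom.app n).toFunctor

/-- The functor between the subcategories of weak equivalences induced by a functor which
preserves the weak equivalences. -/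
def wMap {D : Type u₁} [Category.{v₁} D] {E : Type u₂} [Category.{v₂} E]
    (W : PreWaldhausen D) (W' : PreWaldhausen E) (F : D ⥤ E)
    (hF : ∀ {X Y : D} (f : X ⟶ Y), W.weq f → W'.weq (F.map f)) :
    WideSubcategory W.weq ⥤ WideSubcategory W'.weq where
  obj X := ⟨F.obj X.obj⟩
  map f := ⟨F.map f.hom, hF _ f.property⟩
  map_id X := by ext; exact F.map_id X.obj
  map_comp f g := by ext; exact F.map_comp f.hom g.hom

lemma wMap_congr {D : Type u₁} [Category.{v₁} D] {E : Type u₂} [Category.{v₂} E]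
    (W : PreWaldhausen D) (W' : PreWaldhausen E) {F G : D ⥤ E} (h : F = G)
    (hF : ∀ {X Y : D} (f : X ⟶ Y), W.weq f → W'.weq (F.map f))
    (hG : ∀ {X Y : D} (f : X ⟶ Y), W.weq f → W'.weq (G.map f)) :
    wMap W W' F hF = wMap W W' G hG := by
  subst h; rfl

/-- The simplicial category of weak equivalences `n ↦ w Xₙ`. -/
def w (X : SimplicialPreWaldhausen.{v, u}) : SimplicialObject Cat.{v, u} where
  obj n := Cat.of (WideSubcategory (X.wald n).weq)
  map {m n} α := (wMap (X.wald m) (X.wald n) (X.cat.map α).toFunctor (X.map_weq α)).toCatHom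
  map_id n := by
    apply Cat.ext
    exact wMap_congr (X.wald n) (X.wald n) (G := 𝟭 _)
      (congrArg Cat.Hom.toFunctor (X.cat.map_id n)) (X.map_weq (𝟙 n)) (fun _ hf => hf)
  map_comp {l m n} α β := by
    apply Cat.ext
    exact wMap_congr (X.wald l) (X.wald n)
      (G := (X.cat.map α).toFunctor ⋙ (X.cat.map β).toFunctor)
      (congrArg Cat.Hom.toFunctor (X.cat.map_comp α β)) (X.map_weq (α ≫ β))
      (fun _ hf => X.map_weq β _ (X.map_weq α _ hf))

/-- The simplicial functor `w X ⟶ w Y` induced by a simplicial functor which preserves the weak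
equivalences. -/
def Hom.w {X Y : SimplicialPreWaldhausen.{v, u}} (F : X.Hom Y) :
    SimplicialPreWaldhausen.w X ⟶ SimplicialPreWaldhausen.w Y where
  app n := (wMap (X.wald n) (Y.wald n) (F.hom.app n).toFunctor (F.map_weq n)).toCatHom
  naturality {m n} α := by
    apply Cat.ext
    exact wMap_congr (X.wald m) (Y.wald n)
      (F := (X.cat.map α).toFunctor ⋙ (F.hom.app n).toFunctor)
      (G := (F.hom.app m).toFunctor ⋙ (Y.cat.map α).toFunctor)
      (congrArg Cat.Hom.toFunctor (F.hom.naturality α))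
      (fun _ hf => F.map_weq n _ (X.map_weq α _ hf))
      (fun _ hf => Y.map_weq α _ (F.map_weq m _ hf))

/-- The bisimplicial set `w_• X_•`: in degree `n`, the nerve of the category of weak equivalences
of `Xₙ`. -/
def wNerve (X : SimplicialPreWaldhausen.{v, u}) : SimplicialObject SSet.{max u v} :=
  SimplicialPreWaldhausen.w X ⋙ nerveFunctor.{v, u}

/-- The map of bisimplicial sets `w_• X_• ⟶ w_• Y_•` induced by a simplicial functor which
preserves the weak equivalences. -/
def Hom.wNerve {X Y : SimplicialPreWaldhausen.{v, u}} (F : X.Hom Y) :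
    SimplicialPreWaldhausen.wNerve X ⟶ SimplicialPreWaldhausen.wNerve Y :=
  Functor.whiskerRight (Hom.w F) nerveFunctor.{v, u}

end SimplicialPreWaldhausen

/-! ### Weak equivalences of simplicial and bisimplicial sets -/

/-- The equivalence relation on maps of simplicial sets generated by simplicial homotopy. -/
def Homotopic {X Y : SSet.{w}} : (X ⟶ Y) → (X ⟶ Y) → Prop :=
  Relation.EqvGen fun f g => Nonempty (SSet.Homotopy f g)

/-- A map `f : X ⟶ Y` of simplicial sets is a weak equivalence when for every Kan complex `K`
composition with `f` is a bijection from homotopy classes of maps `Y ⟶ K` to homotopy classes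
of maps `X ⟶ K`; equivalently, when its geometric realization is a (weak) homotopy
equivalence. -/
def IsWeakEquivalence {X Y : SSet.{w}} (f : X ⟶ Y) : Prop :=
  ∀ K : SSet.{w}, SSet.KanComplex K →
    (∀ g h : Y ⟶ K, Homotopic (f ≫ g) (f ≫ h) → Homotopic g h) ∧
    (∀ g : X ⟶ K, ∃ h : Y ⟶ K, Homotopic (f ≫ h) g)

/-- The diagonal simplicial set `n ↦ X_{n,n}` of a bisimplicial set; its geometric realization is
the geometric realization of `X`. -/
def diagonal (X : SimplicialObject SSet.{w}) : SSet.{w} :=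
  Functor.diag SimplexCategoryᵒᵖ ⋙ Functor.uncurry.obj X

/-- The map induced on diagonals. -/
def diagonalMap {X Y : SimplicialObject SSet.{w}} (f : X ⟶ Y) : diagonal X ⟶ diagonal Y :=
  Functor.whiskerLeft (Functor.diag SimplexCategoryᵒᵖ) (Functor.uncurry.map f)

/-- A map of bisimplicial sets is a weak equivalence when the map on diagonals (equivalently, on
geometric realizations) is one. -/
def IsBisimplicialWeakEquivalence {X Y : SimplicialObject SSet.{w}} (f : X ⟶ Y) : Prop :=
  IsWeakEquivalence (diagonalMap f)

/-! ### The constructions `S_•` and `S'_•` -/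

/-- The poset `Ar[n]` of pairs `(i, j)` with `0 ≤ i ≤ j ≤ n`, where `(i, j) ≤ (i', j')` when
`i ≤ i'` and `j ≤ j'`; it is used as a category. -/
abbrev Ar (n : SimplexCategory) : Type :=
  {p : Fin (n.len + 1) × Fin (n.len + 1) // p.1 ≤ p.2}

/-- The functor `Ar[m] ⥤ Ar[n]` given by a monotone map `[m] ⟶ [n]`. -/
def arMap {m n : SimplexCategory} (α : m ⟶ n) : Ar m ⥤ Ar n :=
  Monotone.functor
    (f := fun p : Ar m => (⟨(α.toOrderHom p.1.1, α.toOrderHom p.1.2),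
      α.toOrderHom.monotone p.2⟩ : Ar n))
    (fun _ _ h => ⟨α.toOrderHom.monotone h.1, α.toOrderHom.monotone h.2⟩)

section

variable {C : Type u} [Category.{v} C] {n : SimplexCategory}

/-- The object `A_{i,j}`. -/
abbrev arObj (A : Ar n ⥤ C) {i j : Fin (n.len + 1)} (hij : i ≤ j) : C :=
  A.obj ⟨(i, j), hij⟩

/-- The map `A_{i,j} ⟶ A_{i',j'}` for `i ≤ i'` and `j ≤ j'`. -/
abbrev arHom (A : Ar n ⥤ C) {i j i' j' : Fin (n.len + 1)} (hij : i ≤ j) (hij' : i' ≤ j')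
    (hi : i ≤ i') (hj : j ≤ j') : arObj A hij ⟶ arObj A hij' :=
  A.map (homOfLE (show (⟨(i, j), hij⟩ : Ar n) ≤ ⟨(i', j'), hij'⟩ from ⟨hi, hj⟩))

/-- The component `A_{i,j} ⟶ B_{i,j}` of a natural transformation. -/
abbrev arApp {A B : Ar n ⥤ C} (τ : A ⟶ B) {i j : Fin (n.len + 1)} (hij : i ≤ j) :
    arObj A hij ⟶ arObj B hij :=
  τ.app ⟨(i, j), hij⟩

/-- The square with rows `A_{i,j} ⟶ A_{i,k}` and `A_{j,j} ⟶ A_{j,k}`. -/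
def arSquare (A : Ar n ⥤ C) {i j k : Fin (n.len + 1)} (hij : i ≤ j) (hjk : j ≤ k) :
    Square C where
  f₁₂ := arHom A hij (hij.trans hjk) le_rfl hjk
  f₁₃ := arHom A hij le_rfl hij le_rfl
  f₂₄ := arHom A (hij.trans hjk) hjk hij le_rfl
  f₃₄ := arHom A le_rfl hjk le_rfl hjk
  fac := by
    simp only [← Functor.map_comp]
    rfl

/-- The maps `τ : A ⟶ B` such that every `A_{i,j} ⟶ B_{i,j}` belongs to `P` and every induced map
`A_{i,k} ∪_{A_{i,j}} B_{i,j} ⟶ B_{i,k}` belongs to `Q`. -/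
def arCof (P Q : MorphismProperty C) (n : SimplexCategory) : MorphismProperty (Ar n ⥤ C) :=
  fun A B τ =>
    (∀ (i j : Fin (n.len + 1)) (hij : i ≤ j), P (arApp τ hij)) ∧
    ∀ (i j k : Fin (n.len + 1)) (hij : i ≤ j) (hjk : j ≤ k) (X : C)
      (inl : arObj A (hij.trans hjk) ⟶ X) (inr : arObj B hij ⟶ X)
      (h : IsPushout (arHom A hij (hij.trans hjk) le_rfl hjk) (arApp τ hij) inl inr),
      Q (h.desc (arApp τ (hij.trans hjk)) (arHom B hij (hij.trans hjk) le_rfl hjk)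
        (τ.naturality _))

end

namespace PreWaldhausen

variable {C : Type u} [Category.{v} C] (W : PreWaldhausen C)

/-- The objects of `S_n C`. -/
def sObj (n : SimplexCategory) : ObjectProperty (Ar n ⥤ C) := fun A =>
  (∀ i : Fin (n.len + 1), arObj A (le_refl i) = W.pt) ∧
  (∀ (i j k : Fin (n.len + 1)) (hij : i ≤ j) (hjk : j ≤ k),
    W.cof (arHom A hij (hij.trans hjk) le_rfl hjk)) ∧
  (∀ (i j k : Fin (n.len + 1)) (hij : i ≤ j) (hjk : j ≤ k), (arSquare A hij hjk).IsPushout)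

/-- The objects of `S'_n C`. -/
def sObj' (n : SimplexCategory) : ObjectProperty (Ar n ⥤ C) := fun A =>
  (∀ (i : Fin (n.len + 1)) (f : W.pt ⟶ arObj A (le_refl i)), W.weq f) ∧
  (∀ (i j k : Fin (n.len + 1)) (hij : i ≤ j) (hjk : j ≤ k),
    W.weakCof (arHom A hij (hij.trans hjk) le_rfl hjk)) ∧
  (∀ (i j k : Fin (n.len + 1)) (hij : i ≤ j) (hjk : j ≤ k),
    W.IsHomotopyCocartesian (arSquare A hij hjk))

/-- The pointwise weak equivalences. -/
def levelWeq (n : SimplexCategory) : MorphismProperty (Ar n ⥤ C) :=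
  W.weq.functorCategory (Ar n)

instance (n : SimplexCategory) : (W.levelWeq n).IsMultiplicative where
  id_mem A := fun p => W.weq.id_mem (A.obj p)
  comp_mem _ _ hf hg := fun p => W.weq.comp_mem _ _ (hf p) (hg p)

lemma sObj_restrict {m n : SimplexCategory} (α : m ⟶ n) (A : Ar n ⥤ C) (hA : W.sObj n A) :
    W.sObj m (arMap α ⋙ A) :=
  ⟨fun i => hA.1 (α.toOrderHom i),
   fun _ _ _ hij hjk => hA.2.1 _ _ _ (α.toOrderHom.monotone hij) (α.toOrderHom.monotone hjk),
   fun _ _ _ hij hjk => hA.2.2 _ _ _ (α.toOrderHom.monotone hij) (α.toOrderHom.monotone hjk)⟩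

lemma sObj'_restrict {m n : SimplexCategory} (α : m ⟶ n) (A : Ar n ⥤ C) (hA : W.sObj' n A) :
    W.sObj' m (arMap α ⋙ A) :=
  ⟨fun i => hA.1 (α.toOrderHom i),
   fun _ _ _ hij hjk => hA.2.1 _ _ _ (α.toOrderHom.monotone hij) (α.toOrderHom.monotone hjk),
   fun _ _ _ hij hjk => hA.2.2 _ _ _ (α.toOrderHom.monotone hij) (α.toOrderHom.monotone hjk)⟩

lemma weakCof_of_cof {A B : C} (f : A ⟶ B) (hf : W.cof f) : W.weakCof f :=
  ⟨Arrow.mk f, hf, Relation.EqvGen.refl _⟩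

variable [W.IsWaldhausen]

/-- `S_n C` is contained in `S'_n C`. -/
lemma sObj_le_sObj' (n : SimplexCategory) : W.sObj n ≤ W.sObj' n := by
  intro A hA
  refine ⟨fun i f => ?_, fun i j k hij hjk => W.weakCof_of_cof _ (hA.2.1 i j k hij hjk),
    fun i j k hij hjk => ⟨_, hA.2.2 i j k hij hjk,
      Or.inl ⟨hA.2.1 i j k hij hjk, hA.2.1 j j k le_rfl hjk⟩, Relation.EqvGen.refl _⟩⟩
  have h : IsZero (arObj A (le_refl i)) := by
    rw [hA.1 i]
    exact IsWaldhausen.isZero_pt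
  exact IsWaldhausen.weq_of_isIso f (isIso_of_isInitial
    (IsWaldhausen.isZero_pt (W := W)).isInitial h.isInitial f)

/-- The constant diagram at `*` belongs to `S_n C`. -/
lemma sObj_const (n : SimplexCategory) : W.sObj n ((Functor.const _).obj W.pt) :=
  ⟨fun _ => rfl, fun _ _ _ _ _ => IsWaldhausen.cof_of_isIso _ (inferInstanceAs (IsIso (𝟙 W.pt))),
   fun _ _ _ _ _ => IsPushout.of_id_fst⟩

/-- The Waldhausen structure of `S_n C`: the zero object is the constant diagram at `*`, the weak
equivalences are pointwise, and a map `A ⟶ B` is a w-cofibration when all the maps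
`A_{i,j} ⟶ B_{i,j}` and `A_{i,k} ∪_{A_{i,j}} B_{i,j} ⟶ B_{i,k}` are w-cofibrations. -/
def sWald (n : SimplexCategory) : PreWaldhausen (W.sObj n).FullSubcategory where
  pt := ⟨(Functor.const _).obj W.pt, W.sObj_const n⟩
  cof := (arCof W.cof W.cof n).inverseImage (W.sObj n).ι
  weq := (W.levelWeq n).inverseImage (W.sObj n).ι
  weq_mult := inferInstance

/-- The Waldhausen structure of `S'_n C`: the zero object is the constant diagram at `*`, the weak
equivalences are pointwise, and a map `A ⟶ B` is a w-cofibration when all the maps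
`A_{i,j} ⟶ B_{i,j}` are w-cofibrations and all the maps `A_{i,k} ∪_{A_{i,j}} B_{i,j} ⟶ B_{i,k}`
are weak w-cofibrations. -/
def sWald' (n : SimplexCategory) : PreWaldhausen (W.sObj' n).FullSubcategory where
  pt := ⟨(Functor.const _).obj W.pt, W.sObj_le_sObj' n _ (W.sObj_const n)⟩
  cof := (arCof W.cof W.weakCof n).inverseImage (W.sObj' n).ι
  weq := (W.levelWeq n).inverseImage (W.sObj' n).ι
  weq_mult := inferInstance

/-- The construction `S_• C`; a monotone map `α` acts by precomposition with `arMap α`, so that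
faces delete, and degeneracies repeat, a row and a column. -/
def S : SimplicialPreWaldhausen.{v, max u v} where
  cat :=
    { obj := fun n => Cat.of (W.sObj n.unop).FullSubcategory
      map := fun {m n} α => ((W.sObj n.unop).lift
        ((W.sObj m.unop).ι ⋙ (Functor.whiskeringLeft _ _ C).obj (arMap α.unop))
        (fun A => W.sObj_restrict α.unop A.obj A.property)).toCatHom
      map_id := fun _ => rfl
      map_comp := fun _ _ => rfl }
  wald n := W.sWald n.unop
  map_weq α _ _ _ hf := fun p => hf ((arMap α.unop).obj p)

/-- The construction `S'_• C`. -/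
def S' : SimplicialPreWaldhausen.{v, max u v} where
  cat :=
    { obj := fun n => Cat.of (W.sObj' n.unop).FullSubcategory
      map := fun {m n} α => ((W.sObj' n.unop).lift
        ((W.sObj' m.unop).ι ⋙ (Functor.whiskeringLeft _ _ C).obj (arMap α.unop))
        (fun A => W.sObj'_restrict α.unop A.obj A.property)).toCatHom
      map_id := fun _ => rfl
      map_comp := fun _ _ => rfl }
  wald n := W.sWald' n.unop
  map_weq α _ _ _ hf := fun p => hf ((arMap α.unop).obj p)

/-- The inclusion `S_• C ⟶ S'_• C`. -/
def sInclusion : W.S.Hom W.S' where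
  hom :=
    { app := fun n => (ObjectProperty.ιOfLE (W.sObj_le_sObj' n.unop)).toCatHom
      naturality := fun _ _ _ => rfl }
  map_weq _ _ _ _ hf := hf

end PreWaldhausen

end WaldhausenK

/-!
The topological part reduces the comparison to categories. If `f : X ⟶ Y` is a map of bisimplicial
sets all of whose rows `X_n ⟶ Y_n` are anodyne extensions, then the map on diagonals is anodyne
(`anodyne_diagonalMap`), hence a weak equivalence in the sense of maps into Kan complexes
(`isWeakEquivalence_of_anodyne`). The diagonal is filtered by the least first degree from which a
simplex comes (`relSkeleton`), and each step of the filtration is a pushout of the pushout-product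
of a relative latching inclusion with a monomorphism. In a fixed simplicial degree `n` the row is
the inclusion of nerves of `w S_n C` into `w S'_n C`. The inclusion of a full subcategory is
anodyne on nerves as soon as there is a natural zigzag `id ⟵ Ψ ⟶ Φ` of endofunctors which preserve
the subcategory, with `Φ` taking values in it (`anodyne_nerveMap_weqInclusion`): the natural
transformations give homotopies which deform the large nerve into the small one.

The algebraic part rests on two observations about a saturated category with functorial
factorizations. First, a homotopy cocartesian square whose top arrow is a weak w-cofibration
becomes a pushout up to weak equivalence after the top arrow is replaced by the w-cofibration of
its functorial factorization (`Factorization.IsGood`); this criterion involves no choice of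
zigzag, and it gives two-out-of-three for the fourth corner (`Factorization.weq_of_isGood`).
Second, the classes of w-cofibrations and of weak w-cofibrations share the closure properties
`CofClass`, from which `CofClass.pushout_map` computes the horizontal maps of a pushout of
diagrams. Together with the fact that pushouts commute with pushouts
(`isPushout_of_isPushout_corners`, and its homotopy version
`isHomotopyCocartesian_of_isPushout_corners`) they show that the objects of `S_n C`, up to
isomorphism, and of `S'_n C` are closed under pointwise pushouts along w-cofibrations. Hence both
are Waldhausen categories in which pushouts are pointwise, and exactness of the structure functors
and of the inclusion follows.

The zigzag in degree `n` is `exists_rectification`. The first row `A_{0,0} ⟶ ⋯ ⟶ A_{0,n}` of an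
object `A` of `S'_n C` is replaced functorially by a sequence of w-cofibrations
`* = X_0 ⟶ ⋯ ⟶ X_n`, and then `A_{i,j} ⟵ X_j ∪_{X_i} A_{i,i} ⟶ X_j ∪_{X_i} *` consists of weak equivalences: the
left one because the square `A_{0,i}, A_{0,j}, A_{i,i}, A_{i,j}` is homotopy cocartesian, the
right one by the gluing lemma. The diagram on the right satisfies all the axioms of `S_n C` except
that its diagonal entries are zero objects which need not be equal to `*`; a further isomorphism
of diagrams (`strictify`) corrects this.
-/

namespace WaldhausenK

section

open MonoidalCategory Simplicial HomotopicalAlgebra SSet CartesianMonoidalCategory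

/-! ### Anodyne extensions and homotopies -/

lemma asOrderHom_eq_of_mem_boundary_one {n : SimplexCategoryᵒᵖ} {s : Δ[1].obj n}
    (hs : s ∈ (SSet.boundary.{w} 1).obj n) (i j : Fin (n.unop.len + 1)) :
    stdSimplex.asOrderHom s i = stdSimplex.asOrderHom s j := by
  by_contra h
  refine hs fun k => ?_
  by_cases hi : stdSimplex.asOrderHom s i = k
  · exact ⟨i, hi⟩
  · refine ⟨j, ?_⟩
    revert h hi
    generalize stdSimplex.asOrderHom s i = a
    generalize stdSimplex.asOrderHom s j = b
    revert a b k
    decide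

/-- The map `B ⊗ ∂Δ[1] ⟶ E` which is `u₀` at the vertex `0` and `u₁` at the vertex `1`. -/
noncomputable def tensorBoundaryOneDesc {B E : SSet.{w}} (u₀ u₁ : B ⟶ E) :
    B ⊗ (∂Δ[1] : SSet.{w}) ⟶ E where
  app n := ↾fun x => if stdSimplex.asOrderHom x.2.1 0 = 0 then u₀.app n x.1 else u₁.app n x.1
  naturality n m f := by
    ext ⟨b, s, hs⟩
    have h : stdSimplex.asOrderHom (Δ[1].map f s) 0 = stdSimplex.asOrderHom s 0 :=
      asOrderHom_eq_of_mem_boundary_one hs _ _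
    change (if stdSimplex.asOrderHom (Δ[1].map f s) 0 = 0 then u₀.app m (B.map f b)
      else u₁.app m (B.map f b)) =
      E.map f (if stdSimplex.asOrderHom s 0 = 0 then u₀.app n b else u₁.app n b)
    rw [h]
    split_ifs
    · exact NatTrans.naturality_apply u₀ f b
    · exact NatTrans.naturality_apply u₁ f b

lemma tensorBoundaryOneDesc_comp {B E D : SSet.{w}} (u₀ u₁ : B ⟶ E) (p : E ⟶ D) :
    tensorBoundaryOneDesc u₀ u₁ ≫ p = tensorBoundaryOneDesc (u₀ ≫ p) (u₁ ≫ p) := by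
  ext n ⟨b, s⟩
  change p.app n (if _ then _ else _) = if _ then _ else _
  split_ifs <;> rfl

lemma whiskerRight_tensorBoundaryOneDesc {A B E : SSet.{w}} (i : A ⟶ B) (u₀ u₁ : B ⟶ E) :
    i ▷ _ ≫ tensorBoundaryOneDesc u₀ u₁ = tensorBoundaryOneDesc (i ≫ u₀) (i ≫ u₁) :=
  rfl

lemma whiskerLeft_boundary_ι_eq_desc {B E : SSet.{w}} (H : B ⊗ Δ[1] ⟶ E) :
    B ◁ ∂Δ[1].ι ≫ H = tensorBoundaryOneDesc (ι₀ ≫ H) (ι₁ ≫ H) := by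
  ext n ⟨b, s, hs⟩
  change H.app n (b, s) = if stdSimplex.asOrderHom s 0 = 0 then H.app n (b, _)
    else H.app n (b, _)
  split_ifs with h
  · congr 2
    apply stdSimplex.objEquiv.injective
    ext i : 3
    exact (asOrderHom_eq_of_mem_boundary_one hs _ _).trans h
  · congr 2
    apply stdSimplex.objEquiv.injective
    ext i : 3
    exact (asOrderHom_eq_of_mem_boundary_one hs _ _).trans (Fin.eq_one_of_ne_zero _ h)

/-- Anodyne extensions have the homotopy extension property relative to a fibration: homotopies
can be extended when they are prescribed at both ends. -/
lemma exists_homotopy_of_anodyne {A B E D : SSet.{w}} {i : A ⟶ B} (hi : anodyneExtensions i)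
    {p : E ⟶ D} (hp : modelCategoryQuillen.J.rlp p)
    (u₀ u₁ : B ⟶ E) (HA : A ⊗ Δ[1] ⟶ E) (HD : B ⊗ Δ[1] ⟶ D)
    (h₀ : ι₀ ≫ HA = i ≫ u₀) (h₁ : ι₁ ≫ HA = i ≫ u₁)
    (h₀' : ι₀ ≫ HD = u₀ ≫ p) (h₁' : ι₁ ≫ HD = u₁ ≫ p) (h : HA ≫ p = i ▷ _ ≫ HD) :
    ∃ H : B ⊗ Δ[1] ⟶ E, ι₀ ≫ H = u₀ ∧ ι₁ ≫ H = u₁ ∧ i ▷ _ ≫ H = HA ∧ H ≫ p = HD := by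
  let sq := Functor.PushoutObjObj.ofHasPushout (curriedTensor SSet.{w}) i ∂Δ[1].ι
  have hsq : anodyneExtensions sq.ι := anodyneExtensions_pushoutObjObjι' sq hi
  have := hsq _ hp
  have comm : CommSq (sq.isPushout.desc (tensorBoundaryOneDesc u₀ u₁) HA (by
      change i ▷ _ ≫ _ = A ◁ _ ≫ _
      rw [whiskerLeft_boundary_ι_eq_desc, whiskerRight_tensorBoundaryOneDesc, h₀, h₁]))
      sq.ι p HD := ⟨by
    apply sq.hom_ext
    · rw [IsPushout.inl_desc_assoc, sq.inl_ι_assoc]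
      change _ = B ◁ _ ≫ _
      rw [whiskerLeft_boundary_ι_eq_desc, tensorBoundaryOneDesc_comp, h₀', h₁']
    · rw [IsPushout.inr_desc_assoc, sq.inr_ι_assoc, h]
      rfl⟩
  have e₁ : B ◁ ∂Δ[1].ι ≫ comm.lift = tensorBoundaryOneDesc u₀ u₁ := by
    have := sq.inl ≫= comm.fac_left
    rwa [sq.inl_ι_assoc, IsPushout.inl_desc] at this
  have e₂ : i ▷ _ ≫ comm.lift = HA := by
    have := sq.inr ≫= comm.fac_left
    rwa [sq.inr_ι_assoc, IsPushout.inr_desc] at this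
  rw [whiskerLeft_boundary_ι_eq_desc] at e₁
  have e₃ (n) (b : B.obj n) (s) := congr($(e₁).app n (b, s))
  refine ⟨comm.lift, ?_, ?_, e₂, comm.fac_right⟩
  · ext n b
    exact e₃ n b ⟨stdSimplex.const _ 0 _, fun h => by
      obtain ⟨_, hk⟩ := h 1
      exact zero_ne_one hk⟩
  · ext n b
    exact e₃ n b ⟨stdSimplex.const _ 1 _, fun h => by
      obtain ⟨_, hk⟩ := h 0
      exact one_ne_zero hk⟩

/-- The inclusions of the vertices of `Δ[1]` are anodyne, being horn inclusions. -/
lemma anodyne_stdSimplex_δ (k : Fin 2) : anodyneExtensions (stdSimplex.{w}.δ k) := by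
  intro E D p hp
  have : modelCategoryQuillen.J.rlp p := hp
  rw [← modelCategoryQuillen.fibration_iff] at this
  refine ⟨fun {u b} sq => ?_⟩
  have ne_iff : ∀ j k : Fin 2, j ≠ k + 1 ↔ j = k := by decide
  obtain ⟨φ, h₁, h₂⟩ := horn.IsCompatible.exists_lift (i := k + 1) (f := fun _ _ => u)
    (by simp) p b (fun j hj => by
      obtain rfl : j = k := (ne_iff j k).1 hj
      exact sq.w)
  exact ⟨⟨⟨φ, h₁ k ((ne_iff k k).2 rfl), h₂⟩⟩⟩

/-- The inclusion `B ⟶ B ⊗ Δ[1]` given by a vertex `t` of `Δ[1]`. -/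
noncomputable abbrev cylinderEnd (B : SSet.{w}) (t : (Δ[0] : SSet.{w}) ⟶ Δ[1]) : B ⟶ B ⊗ Δ[1] :=
  lift (𝟙 B) (stdSimplex.isTerminalObj₀.from B ≫ t)

lemma ι₀_eq_cylinderEnd (B : SSet.{w}) : ι₀ = cylinderEnd B (stdSimplex.δ 1) := by
  rw [cylinderEnd, stdSimplex.δ_one_eq_const]; rfl

lemma ι₁_eq_cylinderEnd (B : SSet.{w}) : ι₁ = cylinderEnd B (stdSimplex.δ 0) := by
  rw [cylinderEnd, stdSimplex.δ_zero_eq_const]; rfl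

/-- Homotopies can be extended along a monomorphism, relative to a fibration, when they are
prescribed at one end. -/
lemma exists_homotopy_of_mono {A B E D : SSet.{w}} (i : A ⟶ B) [Mono i]
    {p : E ⟶ D} (hp : modelCategoryQuillen.J.rlp p) {t : (Δ[0] : SSet.{w}) ⟶ Δ[1]}
    (ht : anodyneExtensions t)
    (u : B ⟶ E) (HA : A ⊗ Δ[1] ⟶ E) (HD : B ⊗ Δ[1] ⟶ D)
    (h₀ : cylinderEnd A t ≫ HA = i ≫ u) (h₀' : cylinderEnd B t ≫ HD = u ≫ p)
    (h : HA ≫ p = i ▷ _ ≫ HD) :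
    ∃ H : B ⊗ Δ[1] ⟶ E, cylinderEnd B t ≫ H = u ∧ i ▷ _ ≫ H = HA ∧ H ≫ p = HD := by
  have key (Z : SSet.{w}) : Z ◁ t = fst _ _ ≫ cylinderEnd Z t := by
    ext1
    · simp
    · simp only [whiskerLeft_snd, cylinderEnd, comp_lift, lift_snd, ← Category.assoc]
      exact congrArg (· ≫ t) (stdSimplex.isTerminalObj₀.hom_ext _ _)
  let sq := Functor.PushoutObjObj.ofHasPushout (curriedTensor SSet.{w}) i t
  have hsq : anodyneExtensions sq.ι := anodyneExtensions_pushoutObjObjι sq ht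
  have := hsq _ hp
  have e₀ : B ◁ t ≫ HD = fst _ _ ≫ u ≫ p := by rw [key, Category.assoc, h₀']
  have comm : CommSq (sq.isPushout.desc (fst _ _ ≫ u) HA (by
      change i ▷ _ ≫ _ = A ◁ _ ≫ _
      rw [key, Category.assoc, h₀, whiskerRight_fst_assoc]))
      sq.ι p HD := ⟨by
    apply sq.hom_ext
    · rw [IsPushout.inl_desc_assoc, sq.inl_ι_assoc]
      exact (Category.assoc _ _ _).trans e₀.symm
    · rw [IsPushout.inr_desc_assoc, sq.inr_ι_assoc, h]
      rfl⟩
  have e₁ : B ◁ t ≫ comm.lift = fst _ _ ≫ u := by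
    have := sq.inl ≫= comm.fac_left
    rwa [sq.inl_ι_assoc, IsPushout.inl_desc] at this
  have e₂ : i ▷ _ ≫ comm.lift = HA := by
    have := sq.inr ≫= comm.fac_left
    rwa [sq.inr_ι_assoc, IsPushout.inr_desc] at this
  refine ⟨comm.lift, ?_, e₂, comm.fac_right⟩
  rw [key] at e₁
  have := lift (𝟙 B) (stdSimplex.isTerminalObj₀.from B) ≫= e₁
  simpa only [← Category.assoc, lift_fst, Category.id_comp] using this

/-- Left cancellation for anodyne extensions: a lift along `i ≫ j` agrees with the prescribed map
on `B` up to a homotopy relative to `A`, and this homotopy is extended to `C`. -/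
lemma anodyne_of_comp {A B C : SSet.{w}} (i : A ⟶ B) (j : B ⟶ C) [Mono j]
    (hi : anodyneExtensions i) (hij : anodyneExtensions (i ≫ j)) : anodyneExtensions j := by
  intro E D p hp
  replace hp : modelCategoryQuillen.J.rlp p := hp
  have := hij _ hp
  refine ⟨fun {u v} sq => ?_⟩
  have sq' : CommSq (i ≫ u) (i ≫ j) p v := ⟨by simp [sq.w]⟩
  obtain ⟨l, hl₁, hl₂⟩ : ∃ l : C ⟶ E, (i ≫ j) ≫ l = i ≫ u ∧ l ≫ p = v :=
    ⟨sq'.lift, sq'.fac_left, sq'.fac_right⟩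
  obtain ⟨H, hH₀, hH₁, -, hHp⟩ := exists_homotopy_of_anodyne hi hp (j ≫ l) u
    (fst _ _ ≫ i ≫ u) (fst _ _ ≫ j ≫ v) (by simpa [← Category.assoc, ι₀] using hl₁.symm)
    (by simp [← Category.assoc, ι₁])
    (by rw [← Category.assoc, ι₀_fst, Category.id_comp, Category.assoc, hl₂])
    (by simp [← Category.assoc, ι₁, sq.w]) (by simp [sq.w])
  rw [ι₀_eq_cylinderEnd] at hH₀
  obtain ⟨K, -, hK₁, hKp⟩ := exists_homotopy_of_mono j hp (anodyne_stdSimplex_δ 1) l H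
    (fst _ _ ≫ v) hH₀ (by simp [← Category.assoc, hl₂]) (by simp [hHp])
  exact ⟨⟨⟨ι₁ ≫ K, by rw [← ι₁_comp_assoc, hK₁, hH₁], by
    rw [Category.assoc, hKp, ← Category.assoc, ι₁_fst, Category.id_comp]⟩⟩⟩

/-- The square given by a lifting problem can be solved when a homotopic one can be: here
`(HA, HB)` is a homotopy of endomorphisms of `i`, which is the identity at one end. -/
lemma hasLift_of_homotopy {A B E D : SSet.{w}} (i : A ⟶ B) [Mono i]
    {p : E ⟶ D} (hp : modelCategoryQuillen.J.rlp p) {t t' : (Δ[0] : SSet.{w}) ⟶ Δ[1]}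
    (ht : anodyneExtensions t)
    (HA : A ⊗ Δ[1] ⟶ A) (HB : B ⊗ Δ[1] ⟶ B) (comm : HA ≫ i = i ▷ _ ≫ HB)
    (a : A ⟶ E) (b : B ⟶ D) (sq : a ≫ p = i ≫ b)
    (h : ∃ l : B ⟶ E, i ≫ l = cylinderEnd A t ≫ HA ≫ a ∧ l ≫ p = cylinderEnd B t ≫ HB ≫ b) :
    ∃ l : B ⟶ E, i ≫ l = cylinderEnd A t' ≫ HA ≫ a ∧ l ≫ p = cylinderEnd B t' ≫ HB ≫ b := by
  obtain ⟨l, h₁, h₂⟩ := h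
  obtain ⟨K, -, hK₁, hKp⟩ := exists_homotopy_of_mono i hp ht l (HA ≫ a) (HB ≫ b)
    h₁.symm h₂.symm (by rw [Category.assoc, sq, reassoc_of% comm])
  refine ⟨cylinderEnd B t' ≫ K, ?_, by rw [Category.assoc, hKp]⟩
  have : i ≫ cylinderEnd B t' = cylinderEnd A t' ≫ i ▷ _ := by
    ext1
    · simp
    · simp only [cylinderEnd, Category.assoc, lift_snd, whiskerRight_snd]
      rw [← Category.assoc]
      congr 1
  rw [reassoc_of% this, hK₁]

/-- If there are homotopies of endomorphisms of a monomorphism `i : A ⟶ B`, from `(φA, φB)` to the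
identity and from `(φA, φB)` to a pair such that `B ⟶ B` factors through `A`, then `i` is
anodyne. -/
lemma anodyne_of_deformation {A B : SSet.{w}} (i : A ⟶ B) [Mono i]
    (HA KA : A ⊗ Δ[1] ⟶ A) (HB KB : B ⊗ Δ[1] ⟶ B)
    (commH : HA ≫ i = i ▷ _ ≫ HB) (commK : KA ≫ i = i ▷ _ ≫ KB)
    (h₁ : ι₁ ≫ HB = 𝟙 B) (h₀ : ι₀ ≫ HB = ι₀ ≫ KB)
    (r : B ⟶ A) (hr : ι₁ ≫ KB = r ≫ i) : anodyneExtensions i := by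
  intro E D p hp
  replace hp : modelCategoryQuillen.J.rlp p := hp
  refine ⟨fun {u v} sq => ?_⟩
  have h₁' : ι₁ ≫ HA = 𝟙 A := by
    rw [← cancel_mono i, Category.assoc, commH, ι₁_comp_assoc, h₁]; simp
  have h₀' : ι₀ ≫ HA = ι₀ ≫ KA := by
    rw [← cancel_mono i, Category.assoc, commH, ι₀_comp_assoc, h₀, Category.assoc, commK,
      ι₀_comp_assoc]
  have hr' : ι₁ ≫ KA = i ≫ r := by
    rw [← cancel_mono i, Category.assoc, commK, ι₁_comp_assoc, hr, Category.assoc]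
  have s₁ := hasLift_of_homotopy i hp (t := stdSimplex.δ 0) (t' := stdSimplex.δ 1)
    (anodyne_stdSimplex_δ 0) KA KB commK u v sq.w ⟨r ≫ u, by
      rw [← ι₁_eq_cylinderEnd, reassoc_of% hr'], by
      rw [← ι₁_eq_cylinderEnd, Category.assoc, sq.w, reassoc_of% hr]⟩
  rw [← ι₀_eq_cylinderEnd, ← ι₀_eq_cylinderEnd, ← reassoc_of% h₀, ← reassoc_of% h₀'] at s₁
  have s₂ := hasLift_of_homotopy i hp (t := stdSimplex.δ 1) (t' := stdSimplex.δ 0)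
    (anodyne_stdSimplex_δ 1) HA HB commH u v sq.w (by
      rwa [← ι₀_eq_cylinderEnd, ← ι₀_eq_cylinderEnd])
  rw [← ι₁_eq_cylinderEnd, ← ι₁_eq_cylinderEnd, reassoc_of% h₁, reassoc_of% h₁'] at s₂
  obtain ⟨l, hl⟩ := s₂
  exact ⟨⟨⟨l, hl.1, hl.2⟩⟩⟩

open modelCategoryQuillen in
lemma rlp_terminal_from {K : SSet.{w}} (hK : SSet.KanComplex K) :
    modelCategoryQuillen.J.rlp (terminal.from K) :=
  (fibration_iff _).1 ((isFibrant_iff K).1 hK)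

lemma homotopic_of_comp_homotopic {X Y K : SSet.{w}} {f : X ⟶ Y} (hf : anodyneExtensions f)
    (hK : SSet.KanComplex K) {a b : X ⟶ K} (hab : Homotopic a b) :
    ∀ g h : Y ⟶ K, f ≫ g = a → f ≫ h = b → Homotopic g h := by
  have hK' := rlp_terminal_from hK
  have ext (g h : Y ⟶ K) (H : SSet.Homotopy (f ≫ g) (f ≫ h)) : Homotopic g h := by
    obtain ⟨H', h₀, h₁, -⟩ := exists_homotopy_of_anodyne hf hK' g h H.h (terminal.from _)
      H.h₀ H.h₁ (by simp) (by simp) (by simp)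
    exact .rel _ _ ⟨⟨H', h₀, h₁, by ext _ ⟨⟨_, h⟩, _⟩; exact h.elim⟩⟩
  induction hab with
  | rel a b hab =>
    obtain ⟨H⟩ := hab
    rintro g h rfl rfl
    exact ext g h H
  | refl a =>
    intro g h hg hh
    exact ext g h (RelativeMorphism.Homotopy.ofEq (by rw [hg, hh]))
  | symm a b _ ih => exact fun g h hg hh => .symm _ _ (ih h g hh hg)
  | trans a b c _ _ ih₁ ih₂ =>
    intro g h hg hh
    have := hf _ hK'
    have sq : CommSq b f (terminal.from K) (terminal.from Y) := ⟨by simp⟩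
    exact .trans _ _ _ (ih₁ g sq.lift hg sq.fac_left) (ih₂ sq.lift h sq.fac_left hh)

lemma isWeakEquivalence_of_anodyne {X Y : SSet.{w}} {f : X ⟶ Y} (hf : anodyneExtensions f) :
    IsWeakEquivalence f := by
  intro K hK
  refine ⟨fun g h H => homotopic_of_comp_homotopic hf hK H g h rfl rfl, fun g => ?_⟩
  have hK' := rlp_terminal_from hK
  have := hf _ hK'
  have sq : CommSq g f (terminal.from K) (terminal.from Y) := ⟨by simp⟩
  exact ⟨sq.lift, by rw [sq.fac_left]; exact .refl _⟩

/-! ### Levelwise anodyne maps of bisimplicial sets -/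

/-- Attaching along a map: if `κ : B ⟶ Z` is injective outside the preimage of a subcomplex `F`,
then `F ∪ κ(B)` is obtained from `F` by a pushout. -/
lemma isPushout_fromPreimage {B Z : SSet.{w}} (κ : B ⟶ Z) (F F' : Z.Subcomplex) (h : F ≤ F')
    (hκ : Subcomplex.range κ ≤ F') (hF' : F' ≤ F ⊔ Subcomplex.range κ)
    (inj : ∀ n (x y : B.obj n), κ.app n x ∉ F.obj n → κ.app n y ∉ F.obj n →
      κ.app n x = κ.app n y → x = y) :
    IsPushout (F.fromPreimage κ) (F.preimage κ).ι (Subcomplex.homOfLE h)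
      (Subcomplex.lift κ hκ) where
  w := rfl
  isColimit' := ⟨evaluationJointlyReflectsColimits _ (fun n ↦ by
    refine (isColimitMapCoconePushoutCoconeEquiv _ _).2 (IsPushout.isColimit ?_)
    refine Types.isPushout_of_isPullback_of_mono' ?_ ?_ ?_
    · rw [Types.isPullback_iff]
      refine ⟨rfl, fun x y h => Subtype.ext h.2, fun x y h => ?_⟩
      have h' : x.1 = κ.app n y := congrArg Subtype.val h
      exact ⟨⟨y, by
        change κ.app n y ∈ F.obj n
        rw [← h']; exact x.2⟩, Subtype.ext h'.symm, rfl⟩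
    · refine Set.eq_univ_iff_forall.2 ?_
      rintro ⟨x, hx⟩
      obtain hx | ⟨y, hy⟩ := hF' _ hx
      · exact Or.inl ⟨⟨x, hx⟩, rfl⟩
      · exact Or.inr ⟨y, Subtype.ext hy⟩
    · intro x y hx hy hxy
      exact inj n x y (fun h => hx ⟨⟨x, h⟩, rfl⟩) (fun h => hy ⟨⟨y, h⟩, rfl⟩)
        (congrArg Subtype.val hxy))⟩

section

variable (φ : SimplexCategory ⥤ SimplexCategory)

/-- The simplicial set `n ↦ Y_{φ(n), n}` attached to a bisimplicial set `Y` and an endofunctor `φ`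
of the simplex category. The identity gives the diagonal, constant functors give the rows. -/
def reparam : SimplicialObject SSet.{w} ⥤ SSet.{w} :=
  Functor.uncurry ⋙ (Functor.whiskeringLeft _ _ _).obj (φ.op.prod' (𝟭 _))

variable {X Y : SimplicialObject SSet.{w}} (f : X ⟶ Y)

/-- The `j`-th stage of the skeletal filtration of `n ↦ Y_{φ(n), n}` relative to the image of `X`:
it consists of the simplices in the image of `X` and of those which come from some `Y_{i, n}` with
`i < j`. -/
def relSkeleton (j : ℕ) : ((reparam φ).obj Y).Subcomplex where
  obj n := {y |
    y ∈ Set.range ((f.app (op (φ.obj n.unop))).app n) ∨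
      ∃ (i : ℕ) (_ : i < j) (γ : φ.obj n.unop ⟶ ⦋i⦌) (z : (Y.obj (op ⦋i⦌)).obj n),
        (Y.map γ.op).app n z = y}
  map {n m} g := by
    rintro y (⟨x, rfl⟩ | ⟨i, hi, γ, z, rfl⟩)
    · exact Or.inl ⟨((reparam φ).obj X).map g x,
        NatTrans.naturality_apply ((reparam φ).map f) g x⟩
    · refine Or.inr ⟨i, hi, φ.map g.unop ≫ γ, (Y.obj (op ⦋i⦌)).map g z, ?_⟩
      change _ = (Y.obj _).map g ((Y.map (φ.map g.unop).op).app n ((Y.map γ.op).app n z))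
      rw [op_comp, Functor.map_comp]
      change (Y.map (φ.map g.unop).op).app m ((Y.map γ.op).app m _) = _
      rw [NatTrans.naturality_apply (Y.map γ.op), NatTrans.naturality_apply (Y.map _)]

lemma relSkeleton_monotone : Monotone (relSkeleton φ f) := by
  rintro i j h n y (hy | ⟨k, hk, γ, z, hz⟩)
  · exact Or.inl hy
  · exact Or.inr ⟨k, hk.trans_le h, γ, z, hz⟩

lemma iSup_relSkeleton : ⨆ j, relSkeleton φ f j = ⊤ := by
  rw [← top_le_iff]
  intro n y _
  rw [Subfunctor.iSup_obj, Set.mem_iUnion]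
  refine ⟨(φ.obj n.unop).len + 1, Or.inr ⟨(φ.obj n.unop).len, by omega, 𝟙 _, y, ?_⟩⟩
  change (Y.map (𝟙 _)).app n y = y
  rw [Y.map_id]; rfl

lemma relSkeleton_zero : relSkeleton φ f 0 = Subcomplex.range ((reparam φ).map f) := by
  ext n y
  refine ⟨?_, fun hy => Or.inl hy⟩
  rintro (hy | ⟨i, hi, _⟩)
  · exact hy
  · omega

/-- The simplices of `Y_{j, •}` which lie in the image of `X` or are degenerate in the first
direction. -/
def relLatching (j : ℕ) : (Y.obj (op ⦋j⦌)).Subcomplex where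
  obj n := {y | y ∈ Set.range ((f.app (op ⦋j⦌)).app n) ∨
      ∃ (i : ℕ) (_ : i < j) (γ : ⦋j⦌ ⟶ ⦋i⦌) (z : (Y.obj (op ⦋i⦌)).obj n),
        (Y.map γ.op).app n z = y}
  map {n m} g := by
    rintro y (⟨x, rfl⟩ | ⟨i, hi, γ, z, rfl⟩)
    · exact Or.inl ⟨(X.obj _).map g x, NatTrans.naturality_apply (f.app _) g x⟩
    · exact Or.inr ⟨i, hi, γ, (Y.obj (op ⦋i⦌)).map g z,
        NatTrans.naturality_apply (Y.map γ.op) g z⟩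

/-- The simplicial set `n ↦ Hom(φ(n), [j])`. -/
abbrev reparamSimplex (j : ℕ) : SSet.{w} := φ.op ⋙ Δ[j]

/-- The simplices of `n ↦ Hom(φ(n), [j])` which are not surjective. -/
def reparamBoundary (j : ℕ) : (reparamSimplex.{w} φ j).Subcomplex where
  obj n := {s | ¬ Epi (stdSimplex.objEquiv (n := ⦋j⦌) (m := op (φ.obj n.unop)) s)}
  map {n m} g s hs hs' := hs (by
    have : Epi (φ.map g.unop ≫ stdSimplex.objEquiv s) := hs'
    exact epi_of_epi (φ.map g.unop) _)

/-- The map which attaches the simplices of `Y_{j, •}` to `n ↦ Y_{φ(n), n}`. -/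
def cellMap (Y : SimplicialObject SSet.{w}) (j : ℕ) :
    (Y.obj (op ⦋j⦌)) ⊗ (reparamSimplex.{w} φ j) ⟶ (reparam φ).obj Y where
  app n := ↾fun x => (Y.map (stdSimplex.objEquiv (m := op (φ.obj n.unop)) x.2).op).app n x.1
  naturality n m g := by
    ext ⟨y, s⟩
    change (Y.map (φ.map g.unop ≫ stdSimplex.objEquiv (m := op (φ.obj n.unop)) s).op).app m
      ((Y.obj _).map g y) = (Y.obj _).map g ((Y.map (φ.map g.unop).op).app n
        ((Y.map (stdSimplex.objEquiv (m := op (φ.obj n.unop)) s).op).app n y))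
    rw [op_comp, Functor.map_comp]
    change (Y.map (φ.map g.unop).op).app m ((Y.map _).app m _) = _
    rw [NatTrans.naturality_apply (Y.map _), NatTrans.naturality_apply (Y.map _)]

lemma exists_factor_of_not_epi {Δ : SimplexCategory} {j : ℕ} (s : Δ ⟶ ⦋j⦌) (hs : ¬ Epi s) :
    ∃ (i : ℕ) (_ : i < j) (e : Δ ⟶ ⦋i⦌) (m : ⦋i⦌ ⟶ ⦋j⦌), s = e ≫ m := by
  rw [SimplexCategory.epi_iff_surjective] at hs
  obtain _ | j := j
  · exact absurd (fun y => ⟨0, Subsingleton.elim (α := Fin 1) _ _⟩) hs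
  · obtain ⟨i, θ, h⟩ := SimplexCategory.eq_comp_δ_of_not_surjective s hs
    exact ⟨j, by omega, θ, _, h⟩

lemma preimage_relSkeleton (j : ℕ) :
    (relSkeleton φ f j).preimage (cellMap φ Y j) =
      (relLatching f j).unionProd (reparamBoundary φ j) := by
  ext n ⟨y, s⟩
  refine Iff.trans ?_ (Subcomplex.mem_unionProd_iff _ _ (n := n) (y, s)).symm
  change Δ[j].obj (op (φ.obj n.unop)) at s
  constructor
  · intro h
    by_cases hs : Epi (stdSimplex.objEquiv s)
    · refine Or.inr ?_
      obtain ⟨⟨σ⟩⟩ := isSplitEpi_of_epi (stdSimplex.objEquiv s)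
      have hy : (Y.map σ.section_.op).app n ((Y.map (stdSimplex.objEquiv s).op).app n y) = y := by
        change ((Y.map _) ≫ (Y.map _)).app n y = y
        rw [← Functor.map_comp, ← op_comp, σ.id]
        simp
      obtain ⟨x, hx⟩ | ⟨i, hi, γ, z, hz⟩ := h
      · refine Or.inl ⟨(X.map σ.section_.op).app n x, ?_⟩
        rw [← hy]
        change (X.map _ ≫ f.app _).app n x = _
        rw [f.naturality]
        exact congrArg _ hx
      · refine Or.inr ⟨i, hi, σ.section_ ≫ γ, z, ?_⟩
        rw [← hy, op_comp, Functor.map_comp]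
        exact congrArg ((Y.map σ.section_.op).app n) hz
    · exact Or.inl hs
  · rintro (hs | ⟨x, hx⟩ | ⟨i, hi, γ, z, hz⟩)
    · obtain ⟨i, hi, e, m, he⟩ := exists_factor_of_not_epi (stdSimplex.objEquiv s) hs
      refine Or.inr ⟨i, hi, e, (Y.map m.op).app n y, ?_⟩
      change _ = (Y.map (stdSimplex.objEquiv s).op).app n y
      rw [he, op_comp, Functor.map_comp]; rfl
    · refine Or.inl ⟨(X.map (stdSimplex.objEquiv s).op).app n x, ?_⟩
      change (X.map _ ≫ f.app _).app n x = (Y.map (stdSimplex.objEquiv s).op).app n y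
      rw [f.naturality]
      exact congrArg _ hx
    · refine Or.inr ⟨i, hi, stdSimplex.objEquiv s ≫ γ, z, ?_⟩
      change _ = (Y.map (stdSimplex.objEquiv s).op).app n y
      rw [op_comp, Functor.map_comp]
      exact congrArg _ hz

/-- The Eilenberg-Zilber lemma in the first direction: the attaching map is injective on the
simplices that are not in the previous stage. -/
lemma cellMap_injOn (j : ℕ) (n : SimplexCategoryᵒᵖ)
    (x x' : ((Y.obj (op ⦋j⦌)) ⊗ (reparamSimplex.{w} φ j)).obj n)
    (hx : (cellMap φ Y j).app n x ∉ (relSkeleton φ f j).obj n)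
    (hx' : (cellMap φ Y j).app n x' ∉ (relSkeleton φ f j).obj n)
    (h : (cellMap φ Y j).app n x = (cellMap φ Y j).app n x') : x = x' := by
  change x ∉ ((relSkeleton φ f j).preimage (cellMap φ Y j)).obj n at hx
  change x' ∉ ((relSkeleton φ f j).preimage (cellMap φ Y j)).obj n at hx'
  rw [preimage_relSkeleton] at hx hx'
  replace hx := mt (Subcomplex.mem_unionProd_iff _ _ (n := n) x).2 hx
  replace hx' := mt (Subcomplex.mem_unionProd_iff _ _ (n := n) x').2 hx'
  obtain ⟨y, s⟩ := x
  obtain ⟨y', s'⟩ := x'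
  push Not at hx hx'
  have hs : Epi (stdSimplex.objEquiv (m := op (φ.obj n.unop)) s) := not_not.1 hx.1
  let Z : SSet.{w} := Y ⋙ (evaluation _ _).obj n
  have hy : y ∈ Z.nonDegenerate j := fun ⟨i, hi, γ, z, hz⟩ => hx.2 (Or.inr ⟨i, hi, γ, z, hz⟩)
  have hy' : y' ∈ Z.nonDegenerate j := fun ⟨i, hi, γ, z, hz⟩ => hx'.2 (Or.inr ⟨i, hi, γ, z, hz⟩)
  have h₁ := Z.unique_nonDegenerate_simplex _ _ ⟨y, hy⟩ rfl _ ⟨y', hy'⟩ h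
  have h₂ := Z.unique_nonDegenerate_map _ _ ⟨y, hy⟩ rfl _ ⟨y', hy'⟩ h
  exact Prod.ext (congrArg Subtype.val h₁)
    ((stdSimplex.objEquiv (m := op (φ.obj n.unop))).injective h₂)

lemma anodyne_relSkeleton_succ (j : ℕ) (hj : anodyneExtensions (relLatching f j).ι) :
    anodyneExtensions (Subcomplex.homOfLE (relSkeleton_monotone φ f j.le_succ)) := by
  have sq := isPushout_fromPreimage (cellMap φ Y j) (relSkeleton φ f j) (relSkeleton φ f (j + 1))
    (relSkeleton_monotone φ f j.le_succ)
    (by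
      rintro n _ ⟨⟨y, s⟩, rfl⟩
      exact Or.inr ⟨j, by omega, stdSimplex.objEquiv (m := op (φ.obj n.unop)) s, y, rfl⟩)
    (by
      rintro n y (hy | ⟨i, hi, γ, z, rfl⟩)
      · exact Or.inl (Or.inl hy)
      · obtain hi | rfl := Nat.lt_succ_iff_lt_or_eq.1 hi
        · exact Or.inl (Or.inr ⟨i, hi, γ, z, rfl⟩)
        · exact Or.inr ⟨⟨z, stdSimplex.objEquiv.symm γ⟩, by
            change (Y.map (stdSimplex.objEquiv _).op).app n z = _
            rw [Equiv.apply_symm_apply]⟩)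
    (cellMap_injOn φ f j)
  refine anodyneExtensions.of_isPushout sq ?_
  rw [preimage_relSkeleton]
  exact anodyneExtensions_unionProd_ι' _ _ hj

lemma anodyne_relSkeleton_of_le (j : ℕ)
    (h : ∀ i < j, anodyneExtensions (relLatching f i).ι) :
    anodyneExtensions (Subcomplex.homOfLE (relSkeleton_monotone φ f j.zero_le)) := by
  induction j with
  | zero => exact anodyneExtensions.id_mem _
  | succ j ih =>
    exact anodyneExtensions.comp_mem _ _ (ih fun i hi => h i (by omega))
      (anodyne_relSkeleton_succ φ f j (h j (by omega)))

lemma anodyne_relSkeleton_zero_ι (h : ∀ i, anodyneExtensions (relLatching f i).ι) :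
    anodyneExtensions (relSkeleton φ f 0).ι := by
  refine MorphismProperty.transfiniteCompositionsOfShape_le _ ℕ _ ⟨?_⟩
  exact {
    F := (relSkeleton_monotone φ f).functor ⋙ Subcomplex.toSSetFunctor
    isoBot := Iso.refl _
    incl := { app _ := Subcomplex.ι _ }
    isColimit := IsColimit.ofIsoColimit (isColimitOfPreserves (Subcomplex.toSSetFunctor)
      ((CompleteLattice.colimitCocone ((relSkeleton_monotone φ f).functor)).isColimit))
        (Cocone.ext (Subcomplex.eqToIso (iSup_relSkeleton φ f) ≪≫ Subcomplex.topIso _))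
    map_mem j _ := anodyne_relSkeleton_succ φ f j (h j) }

lemma anodyne_relSkeleton_zero_ι_iff [Mono ((reparam φ).map f)] :
    anodyneExtensions (relSkeleton φ f 0).ι ↔ anodyneExtensions ((reparam φ).map f) := by
  rw [relSkeleton_zero]
  exact anodyneExtensions.arrow_mk_iso_iff
    (Arrow.isoMk (asIso (Subcomplex.toRange ((reparam φ).map f))).symm (Iso.refl _)
      (by simp [IsIso.inv_comp_eq]))

end

/-- The row `Y_{j, •}` as a special case of `reparam`. -/
def reparamConstIso (j : SimplexCategory) :
    reparam.{w} ((Functor.const _).obj j) ≅ (evaluation _ _).obj (op j) :=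
  NatIso.ofComponents (fun Y => NatIso.ofComponents (fun n => Iso.refl _) (by
    intro n m g
    ext y
    change (Y.obj _).map g ((Y.map (𝟙 _)).app n y) = (Y.obj _).map g y
    rw [Y.map_id]; rfl)) (fun _ => by ext; rfl)

/-- The skeletal filtration of the constant reparametrization at `[j]` has the relative latching
object of `Y_{j, •}` as its `j`-th stage, and the earlier stages are attached along the relative
latching inclusions of smaller degree, so that left cancellation applies to
`X_{j, •} ⟶ relLatching f j ⟶ Y_{j, •}`. -/
lemma anodyne_relLatching_ι {X Y : SimplicialObject SSet.{w}} (f : X ⟶ Y)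
    (hf₀ : ∀ n, Mono (f.app n)) (hf : ∀ n, anodyneExtensions (f.app n)) (j : ℕ) :
    anodyneExtensions (relLatching f j).ι := by
  induction j using Nat.strong_induction_on with | _ j ih
  let φ : SimplexCategory ⥤ SimplexCategory := (Functor.const _).obj ⦋j⦌
  let e : Arrow.mk ((reparam φ).map f) ≅ Arrow.mk (f.app (op ⦋j⦌)) :=
    Arrow.isoMk ((reparamConstIso ⦋j⦌).app X) ((reparamConstIso ⦋j⦌).app Y)
      ((reparamConstIso ⦋j⦌).hom.naturality f).symm
  have := hf₀ (op ⦋j⦌)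
  have : Mono ((reparam φ).map f) :=
    (MorphismProperty.arrow_mk_iso_iff (.monomorphisms _) e).2 (inferInstanceAs (Mono (f.app _)))
  have h₀ : anodyneExtensions (relSkeleton φ f 0).ι := by
    rw [anodyne_relSkeleton_zero_ι_iff, anodyneExtensions.arrow_mk_iso_iff e]
    exact hf _
  have h₁ : anodyneExtensions (relSkeleton φ f j).ι :=
    anodyne_of_comp _ _ (anodyne_relSkeleton_of_le φ f j ih) h₀
  refine (anodyneExtensions.arrow_mk_iso_iff ?_).1 h₁
  let e' := (reparamConstIso ⦋j⦌).app Y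
  refine Arrow.isoMk ⟨Subcomplex.lift ((relSkeleton φ f j).ι ≫ e'.hom) ?_,
    Subcomplex.lift ((relLatching f j).ι ≫ e'.inv) ?_, ?_, ?_⟩ e' ?_
  · rintro n _ ⟨⟨y, hy⟩, rfl⟩
    exact hy
  · rintro n _ ⟨⟨y, hy⟩, rfl⟩
    exact hy
  · rfl
  · rfl
  · rfl

lemma mono_of_mono_app_app {X Y : SSet.{w}} (f : X ⟶ Y)
    (h : ∀ n : SimplexCategoryᵒᵖ, Function.Injective (f.app n)) : Mono f := by
  have (n : SimplexCategoryᵒᵖ) : Mono (f.app n) := (mono_iff_injective _).2 (h n)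
  exact NatTrans.mono_of_mono_app f

/-- A map of bisimplicial sets which is anodyne in each degree of the first direction is anodyne on
the diagonals. -/
theorem anodyne_diagonalMap {X Y : SimplicialObject SSet.{w}} (f : X ⟶ Y)
    (hf₀ : ∀ n, Mono (f.app n)) (hf : ∀ n, anodyneExtensions (f.app n)) :
    anodyneExtensions (diagonalMap f) := by
  have : Mono ((reparam (𝟭 _)).map f) := mono_of_mono_app_app _ fun n x y h => by
    have := hf₀ n
    have : Mono ((f.app n).app n) := inferInstance
    exact (mono_iff_injective _).1 this h
  exact (anodyne_relSkeleton_zero_ι_iff (𝟭 _) f).1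
    (anodyne_relSkeleton_zero_ι _ f (anodyne_relLatching_ι f hf₀ hf))

/-! ### Nerves and deformations of categories -/

section

variable {P Q : Type u} [Category.{v} P] [Category.{v} Q]

/-- The simplicial homotopy between maps of nerves given by a natural transformation. -/
noncomputable def nerveHomotopy {F G : P ⥤ Q} (α : F ⟶ G) : nerve P ⊗ Δ[1] ⟶ nerve Q where
  app n := ↾fun x => (((stdSimplex.asOrderHom x.2).monotone.functor.prod' x.1 ⋙
    Functor.uncurry.obj (ComposableArrows.mk₁ α) : Fin (n.unop.len + 1) ⥤ Q) :
      ComposableArrows Q n.unop.len)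
  naturality _ _ _ := rfl

lemma ι₀_nerveHomotopy {F G : P ⥤ Q} (α : F ⟶ G) : ι₀ ≫ nerveHomotopy α = nerveMap F := by
  ext n x
  change Fin (n.unop.len + 1) ⥤ P at x
  refine CategoryTheory.Functor.ext (fun _ => rfl) fun i j f => ?_
  change 𝟙 _ ≫ F.map (x.map f) = 𝟙 _ ≫ F.map (x.map f) ≫ 𝟙 _
  rw [Category.comp_id]

lemma ι₁_nerveHomotopy {F G : P ⥤ Q} (α : F ⟶ G) : ι₁ ≫ nerveHomotopy α = nerveMap G := by
  ext n x
  change Fin (n.unop.len + 1) ⥤ P at x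
  refine CategoryTheory.Functor.ext (fun _ => rfl) fun i j f => ?_
  change 𝟙 _ ≫ G.map (x.map f) = 𝟙 _ ≫ G.map (x.map f) ≫ 𝟙 _
  rw [Category.comp_id]

lemma nerveHomotopy_obj {F G : P ⥤ Q} (α : F ⟶ G) {n : SimplexCategoryᵒᵖ}
    (x : (nerve P).obj n) (s : Δ[1].obj n) (k : Fin (n.unop.len + 1)) :
    ((nerveHomotopy α).app n (x, s) : ComposableArrows Q _).obj k = F.obj (x.obj k) ∨
    ((nerveHomotopy α).app n (x, s) : ComposableArrows Q _).obj k = G.obj (x.obj k) := by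
  change ((ComposableArrows.mk₁ α).obj (stdSimplex.asOrderHom s k)).obj _ = _ ∨
    ((ComposableArrows.mk₁ α).obj (stdSimplex.asOrderHom s k)).obj _ = _
  generalize stdSimplex.asOrderHom s k = t
  match t with
  | 0 => exact Or.inl rfl
  | 1 => exact Or.inr rfl

variable (I : P ⥤ Q) [I.Faithful]

lemma mono_nerveMap (hI : Function.Injective I.obj) : Mono (nerveMap I) := by
  refine mono_of_mono_app_app _ fun n x y h => ?_
  change Fin (n.unop.len + 1) ⥤ P at x y
  have h' : x ⋙ I = y ⋙ I := h
  refine CategoryTheory.Functor.ext (fun i => hI (Functor.congr_obj h' i)) fun i j f =>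
    I.map_injective ?_
  have := Functor.congr_hom h' f
  simpa [eqToHom_map] using this

variable [I.Full]

/-- The image of a fully faithful functor on nerves consists of the strings of morphisms between
objects in the image. -/
lemma mem_range_nerveMap {n : SimplexCategoryᵒᵖ} (x : (nerve Q).obj n)
    (hx : ∀ k, x.obj k ∈ Set.range I.obj) : x ∈ (Subcomplex.range (nerveMap I)).obj n := by
  change Fin (n.unop.len + 1) ⥤ Q at x
  choose p hp using hx
  refine ⟨(({
    obj := p
    map {i j} f := I.preimage (eqToHom (hp i) ≫ x.map f ≫ eqToHom (hp j).symm)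
    map_id i := I.map_injective (by simp)
    map_comp f g := I.map_injective (by simp) } : Fin (n.unop.len + 1) ⥤ P) :
      ComposableArrows P _), ?_⟩
  exact CategoryTheory.Functor.ext hp fun i j f => I.map_preimage _

/-- A full subcategory `P` of `Q` is included in `Q` by an anodyne map of nerves if there is a
zigzag of natural transformations `𝟭 ⟵ Ψ ⟶ Φ` such that `Ψ` preserves `P` and `Φ` takes values in
`P`. -/
theorem anodyne_nerveMap (hI : Function.Injective I.obj) (Ψ Φ : Q ⥤ Q) (α : Ψ ⟶ 𝟭 Q) (β : Ψ ⟶ Φ)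
    (hΨ : ∀ p, Ψ.obj (I.obj p) ∈ Set.range I.obj) (hΦ : ∀ q, Φ.obj q ∈ Set.range I.obj) :
    anodyneExtensions (nerveMap I) := by
  have := mono_nerveMap I hI
  let R := Subcomplex.range (nerveMap I)
  have key {F G : Q ⥤ Q} (γ : F ⟶ G) (hF : ∀ p, F.obj (I.obj p) ∈ Set.range I.obj)
      (hG : ∀ p, G.obj (I.obj p) ∈ Set.range I.obj) :
      Subcomplex.range (R.ι ▷ _ ≫ nerveHomotopy γ) ≤ R := by
    rintro n _ ⟨⟨⟨_, ⟨x, rfl⟩⟩, s⟩, rfl⟩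
    refine mem_range_nerveMap I _ fun k => ?_
    obtain h | h := nerveHomotopy_obj γ ((nerveMap I).app n x) s k
    · exact h.symm ▸ hF _
    · exact h.symm ▸ hG _
  have h : anodyneExtensions R.ι := by
    refine anodyne_of_deformation R.ι (Subcomplex.lift _ (key α hΨ fun p => ⟨p, rfl⟩))
      (Subcomplex.lift _ (key β hΨ fun p => hΦ _)) (nerveHomotopy α) (nerveHomotopy β)
      rfl rfl ?_ ?_ (Subcomplex.lift (nerveMap Φ) ?_) ?_
    · rw [ι₁_nerveHomotopy]; rfl
    · rw [ι₀_nerveHomotopy, ι₀_nerveHomotopy]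
    · rintro n _ ⟨x, rfl⟩
      exact mem_range_nerveMap I _ fun k => hΦ _
    · rw [ι₁_nerveHomotopy]; rfl
  refine (anodyneExtensions.arrow_mk_iso_iff ?_).1 h
  exact Arrow.isoMk (asIso (Subcomplex.toRange (nerveMap I))).symm (Iso.refl _)
      (by simp [IsIso.inv_comp_eq, R])

end

section

variable {D : Type u} [Category.{v} D] {p q : ObjectProperty D} (h : p ≤ q) (w : MorphismProperty D)
  [w.IsMultiplicative]

/-- The category of the objects which satisfy `p` and the morphisms in `w`. -/
abbrev WeqSubcategory (p : ObjectProperty D) (w : MorphismProperty D) [w.IsMultiplicative] :=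
  WideSubcategory (w.inverseImage p.ι)

/-- The inclusion of categories of weak equivalences given by an inclusion of classes of objects. -/
def weqInclusion : WeqSubcategory p w ⥤ WeqSubcategory q w where
  obj X := ⟨(ObjectProperty.ιOfLE h).obj X.obj⟩
  map f := ⟨(ObjectProperty.ιOfLE h).map f.hom, f.property⟩

instance : (weqInclusion h w).Faithful := ⟨fun {_ _ f g} hfg => by
  ext
  exact congrArg (fun k => k.hom.hom) hfg⟩

lemma weqInclusion_obj_injective : Function.Injective (weqInclusion h w).obj := by
  rintro ⟨⟨X, hX⟩⟩ ⟨⟨Y, hY⟩⟩ hXY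
  obtain rfl : X = Y := congrArg (fun Z => Z.obj.obj) hXY
  rfl

/-- The endofunctor of `WeqSubcategory q w` given by a functor on the full subcategory. -/
def weqFunctor (F : q.FullSubcategory ⥤ D) (hF : ∀ X, q (F.obj X))
    (hF' : ∀ {X Y : q.FullSubcategory} (f : X ⟶ Y), w f.hom → w (F.map f)) :
    WeqSubcategory q w ⥤ WeqSubcategory q w where
  obj X := ⟨⟨F.obj X.obj, hF _⟩⟩
  map f := ⟨⟨F.map f.hom⟩, hF' _ f.property⟩
  map_id X := by ext; exact F.map_id X.obj
  map_comp f g := by ext; exact F.map_comp f.hom g.hom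

/-- The inclusion of the weak equivalences between objects of `p` into those between objects of `q`
is anodyne on nerves if there is a natural zigzag of weak equivalences `X ⟵ Ψ X ⟶ Φ X` such that
`Ψ` preserves `p` and `Φ` takes values in `p`. -/
theorem anodyne_nerveMap_weqInclusion
    (Ψ Φ : q.FullSubcategory ⥤ D) (α : Ψ ⟶ q.ι) (β : Ψ ⟶ Φ)
    (hα : ∀ X, w (α.app X)) (hβ : ∀ X, w (β.app X))
    (hΨ : ∀ X, q (Ψ.obj X)) (hΦ : ∀ X, p (Φ.obj X)) (hΨp : ∀ X, p X.obj → p (Ψ.obj X))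
    (hΨ' : ∀ {X Y : q.FullSubcategory} (f : X ⟶ Y), w f.hom → w (Ψ.map f))
    (hΦ' : ∀ {X Y : q.FullSubcategory} (f : X ⟶ Y), w f.hom → w (Φ.map f)) :
    anodyneExtensions (nerveMap (weqInclusion h w)) := by
  have : (weqInclusion h w).Full := ⟨fun f => ⟨⟨⟨f.hom.hom⟩, f.property⟩, rfl⟩⟩
  refine anodyne_nerveMap (weqInclusion h w) (weqInclusion_obj_injective h w)
    (weqFunctor w Ψ hΨ hΨ')
    (weqFunctor w Φ (fun X => h _ (hΦ X)) hΦ')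
    { app X := ⟨⟨α.app X.obj⟩, hα _⟩
      naturality X Y f := by ext; exact α.naturality f.hom }
    { app X := ⟨⟨β.app X.obj⟩, hβ _⟩
      naturality X Y f := by ext; exact β.naturality f.hom } ?_ ?_
  · rintro ⟨⟨X, hX⟩⟩
    exact ⟨⟨⟨_, hΨp ⟨X, h _ hX⟩ hX⟩⟩, rfl⟩
  · rintro ⟨⟨X, hX⟩⟩
    exact ⟨⟨⟨_, hΦ ⟨X, hX⟩⟩⟩, rfl⟩

end

end

namespace PreWaldhausen

variable {C : Type u} [Category.{v} C] {W : PreWaldhausen C}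

/-! ### Weak w-cofibrations -/

lemma weakCof_iff_of_arrowWeq {A B A' B' : C} {f : A ⟶ B} {g : A' ⟶ B'} (a : A ⟶ A') (b : B ⟶ B')
    (h : f ≫ b = a ≫ g) (ha : W.weq a) (hb : W.weq b) : W.weakCof f ↔ W.weakCof g := by
  have hz : Zigzag W.arrowWeq (Arrow.mk f) (Arrow.mk g) :=
    Relation.EqvGen.rel _ _ ⟨Arrow.homMk a b h.symm, ha, hb⟩
  constructor
  · rintro ⟨k, hk, hk'⟩
    exact ⟨k, hk, (hz.symm _ _).trans _ _ _ hk'⟩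
  · rintro ⟨k, hk, hk'⟩
    exact ⟨k, hk, hz.trans _ _ _ hk'⟩

variable (W) in
/-- A functorial factorization of the weak w-cofibrations. -/
structure Factorization where
  /-- the intermediate object -/
  T : W.weakCofArrow.FullSubcategory ⥤ C
  /-- the w-cofibration of the factorization -/
  iNat : W.weakCofArrow.ι ⋙ Arrow.leftFunc ⟶ T
  /-- the weak equivalence of the factorization -/
  pNat : T ⟶ W.weakCofArrow.ι ⋙ Arrow.rightFunc
  prop f : iNat.app f ≫ pNat.app f = f.obj.hom ∧ W.cof (iNat.app f) ∧ W.weq (pNat.app f)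

namespace Factorization

variable (D : W.Factorization) {A B A' B' : C} {f : A ⟶ B} (hf : W.weakCof f)
  {f' : A' ⟶ B'} (hf' : W.weakCof f')

/-- The intermediate object of the factorization of a weak w-cofibration. -/
def mid : C := D.T.obj ⟨Arrow.mk f, hf⟩

/-- The w-cofibration of the factorization of a weak w-cofibration. -/
def i : A ⟶ D.mid hf := D.iNat.app ⟨Arrow.mk f, hf⟩

/-- The weak equivalence of the factorization of a weak w-cofibration. -/
def p : D.mid hf ⟶ B := D.pNat.app ⟨Arrow.mk f, hf⟩

@[simp]
lemma fac : D.i hf ≫ D.p hf = f := (D.prop _).1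

@[simp]
lemma fac_assoc {X : C} (g : B ⟶ X) : D.i hf ≫ D.p hf ≫ g = f ≫ g := by
  rw [← Category.assoc, fac]

lemma cof_i : W.cof (D.i hf) := (D.prop _).2.1

lemma weq_p : W.weq (D.p hf) := (D.prop _).2.2

/-- The functoriality of the factorization of weak w-cofibrations. -/
def map (a : A ⟶ A') (b : B ⟶ B') (h : f ≫ b = a ≫ f') : D.mid hf ⟶ D.mid hf' :=
  D.T.map ⟨Arrow.homMk (f := Arrow.mk f) (g := Arrow.mk f') a b h.symm⟩

@[simp]
lemma i_map (a : A ⟶ A') (b : B ⟶ B') (h : f ≫ b = a ≫ f') :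
    D.i hf ≫ D.map hf hf' a b h = a ≫ D.i hf' :=
  (D.iNat.naturality
    (⟨Arrow.homMk a b h.symm⟩ : (⟨Arrow.mk f, hf⟩ : W.weakCofArrow.FullSubcategory) ⟶
      ⟨Arrow.mk f', hf'⟩)).symm

@[simp]
lemma map_p (a : A ⟶ A') (b : B ⟶ B') (h : f ≫ b = a ≫ f') :
    D.map hf hf' a b h ≫ D.p hf' = D.p hf ≫ b :=
  D.pNat.naturality
    (⟨Arrow.homMk a b h.symm⟩ : (⟨Arrow.mk f, hf⟩ : W.weakCofArrow.FullSubcategory) ⟶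
      ⟨Arrow.mk f', hf'⟩)

lemma i_map_assoc (a : A ⟶ A') (b : B ⟶ B') (h : f ≫ b = a ≫ f') {X : C}
    (g : D.mid hf' ⟶ X) : D.i hf ≫ D.map hf hf' a b h ≫ g = a ≫ D.i hf' ≫ g := by
  rw [← Category.assoc, i_map, Category.assoc]

lemma map_p_assoc (a : A ⟶ A') (b : B ⟶ B') (h : f ≫ b = a ≫ f') {X : C}
    (g : B' ⟶ X) : D.map hf hf' a b h ≫ D.p hf' ≫ g = D.p hf ≫ b ≫ g := by
  rw [← Category.assoc, map_p, Category.assoc]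

end Factorization

lemma weakCof_of_fac {A B X : C} {i : A ⟶ X} {p : X ⟶ B} (hi : W.cof i) (hp : W.weq p) :
    W.weakCof (i ≫ p) :=
  (weakCof_iff_of_arrowWeq (𝟙 A) p (Category.id_comp _).symm (W.weq.id_mem _) hp).1
    (W.weakCof_of_cof i hi)

lemma isHomotopyCocartesian_iff_of_squareWeq {sq sq' : Square C} (φ : sq ⟶ sq')
    (hφ : W.squareWeq φ) : W.IsHomotopyCocartesian sq ↔ W.IsHomotopyCocartesian sq' := by
  have hz : Zigzag W.squareWeq sq sq' := Relation.EqvGen.rel _ _ ⟨φ, hφ⟩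
  constructor
  · rintro ⟨k, hk, hk', hk''⟩
    exact ⟨k, hk, hk', (hz.symm _ _).trans _ _ _ hk''⟩
  · rintro ⟨k, hk, hk', hk''⟩
    exact ⟨k, hk, hk', hz.trans _ _ _ hk''⟩

variable [W.IsWaldhausen]

lemma weakCof_comp (D : W.Factorization) {A B X : C} {f : A ⟶ B} {g : B ⟶ X}
    (hf : W.weakCof f) (hg : W.weakCof g) : W.weakCof (f ≫ g) := by
  have h : W.weakCof (D.p hf ≫ g) :=
    (weakCof_iff_of_arrowWeq (D.p hf) (𝟙 _) (Category.comp_id _) (D.weq_p hf)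
      (W.weq.id_mem _)).2 hg
  have := weakCof_of_fac (IsWaldhausen.cof_comp _ _ (D.cof_i hf) (D.cof_i h)) (D.weq_p h)
  simpa using this

lemma cof_inl {A B X P : C} {f : A ⟶ B} {g : A ⟶ X} {inl : B ⟶ P} {inr : X ⟶ P}
    (h : IsPushout f g inl inr) (hg : W.cof g) : W.cof inl :=
  IsWaldhausen.cof_cobaseChange h.flip hg

/-! ### Classes of maps which behave like w-cofibrations -/

/-- The closure properties common to the classes of w-cofibrations and of weak w-cofibrations
which are used to build pushouts of diagrams. -/
structure CofClass (W : PreWaldhausen C) (Q : MorphismProperty C) : Prop where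
  of_isIso : ∀ {X Y : C} (f : X ⟶ Y), IsIso f → Q f
  comp : ∀ {X Y Z : C} {f : X ⟶ Y} {g : Y ⟶ Z}, Q f → Q g → Q (f ≫ g)
  cobase : ∀ {A B X P : C} {f : A ⟶ B} {g : A ⟶ X} {inl : B ⟶ P} {inr : X ⟶ P},
    IsPushout f g inl inr → W.cof f → Q g → Q inl
  relative : ∀ {A M B X P P' : C} {m : A ⟶ M} {n : M ⟶ B} {x : A ⟶ X}
    {inl : M ⟶ P} {inr : X ⟶ P} {inl' : B ⟶ P'} {inr' : X ⟶ P'} {r : P ⟶ P'},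
    IsPushout m x inl inr → IsPushout (m ≫ n) x inl' inr' → W.cof m → W.cof (m ≫ n) → Q n →
    inl ≫ r = n ≫ inl' → inr ≫ r = inr' → Q r

lemma cofClass_cof : CofClass W W.cof where
  of_isIso := IsWaldhausen.cof_of_isIso
  comp := IsWaldhausen.cof_comp _ _
  cobase h _ hg := cof_inl h hg
  relative {A M B X P P' m n x inl inr inl' inr' r} h h' _ _ hn h₁ h₂ := by
    subst h₂
    exact IsWaldhausen.cof_cobaseChange 
      (IsPushout.of_left (h₂₁ := inr) (h₂₂ := r) (by simpa using h') h₁.symm h) hn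

lemma cofClass_weakCof (D : W.Factorization) : CofClass W W.weakCof where
  of_isIso f hf := W.weakCof_of_cof f (IsWaldhausen.cof_of_isIso f hf)
  comp := weakCof_comp D
  cobase {A B X P f g inl inr} h hf hg := by
    have := IsWaldhausen.hasPushout f (D.i hg) hf
    have h' := IsPushout.of_hasPushout f (D.i hg)
    let c : pushout f (D.i hg) ⟶ P := h'.desc inl (D.p hg ≫ inr) (by simp [h.w])
    have hc : pushout.inl f (D.i hg) ≫ c = inl := h'.inl_desc _ _ _
    rw [← hc]
    refine weakCof_of_fac (cof_inl h' (D.cof_i hg)) ?_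
    exact IsWaldhausen.gluing (𝟙 A) (𝟙 B) (D.p hg) c h' h hf hf (by simp) (by simp)
      (by simpa using hc) (h'.inr_desc _ _ _) (W.weq.id_mem _) (W.weq.id_mem _) (D.weq_p hg)
  relative {A M B X P P' m n x inl inr inl' inr' r} h h' hm hmn hn h₁ h₂ := by
    have hmi : W.cof (m ≫ D.i hn) := IsWaldhausen.cof_comp _ _ hm (D.cof_i hn)
    have := IsWaldhausen.hasPushout (D.i hn) inl (D.cof_i hn)
    have hT := IsPushout.of_hasPushout (D.i hn) inl
    have hT' := h.paste_horiz hT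
    let c : pushout (D.i hn) inl ⟶ P' := hT.desc (D.p hn ≫ inl') r (by simp [h₁])
    have hc : pushout.inr (D.i hn) inl ≫ c = r := hT.inr_desc _ _ _
    rw [← hc]
    refine weakCof_of_fac (IsWaldhausen.cof_cobaseChange hT (D.cof_i hn)) ?_
    exact IsWaldhausen.gluing (𝟙 A) (D.p hn) (𝟙 X) c hT' h' hmi hmn (by simp) (by simp)
      (hT.inl_desc _ _ _) (by simp [hc, h₂]) (W.weq.id_mem _) (D.weq_p hn) (W.weq.id_mem _)

/-- A map of spans whose relative latching map `A₂ ∪_{A₁} B₁ ⟶ B₂` and whose component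
`X₁ ⟶ X₂` belong to a cofibration-like class induces a map of that class on pushouts. -/
lemma CofClass.pushout_map {Q : MorphismProperty C} (hQ : CofClass W Q)
    {A₁ B₁ X₁ P₁ A₂ B₂ X₂ P₂ M : C}
    {f₁ : A₁ ⟶ B₁} {x₁ : A₁ ⟶ X₁} {inl₁ : B₁ ⟶ P₁} {inr₁ : X₁ ⟶ P₁}
    {f₂ : A₂ ⟶ B₂} {x₂ : A₂ ⟶ X₂} {inl₂ : B₂ ⟶ P₂} {inr₂ : X₂ ⟶ P₂}
    (h₁ : IsPushout f₁ x₁ inl₁ inr₁) (h₂ : IsPushout f₂ x₂ inl₂ inr₂)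
    (hf₁ : W.cof f₁) (hf₂ : W.cof f₂)
    (a : A₁ ⟶ A₂) (b : B₁ ⟶ B₂) (x : X₁ ⟶ X₂) (p : P₁ ⟶ P₂)
    (hax : x₁ ≫ x = a ≫ x₂)
    (hbp : inl₁ ≫ p = b ≫ inl₂) (hxp : inr₁ ≫ p = x ≫ inr₂)
    {mB : B₁ ⟶ M} {mA : A₂ ⟶ M} (hM : IsPushout f₁ a mB mA) (n : M ⟶ B₂)
    (hnB : mB ≫ n = b) (hnA : mA ≫ n = f₂) (hn : Q n) (hx : Q x) : Q p := by
  have hinr₁ : W.cof inr₁ := IsWaldhausen.cof_cobaseChange h₁ hf₁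
  have := IsWaldhausen.hasPushout inr₁ x hinr₁
  have hR := IsPushout.of_hasPushout inr₁ x
  set rP := pushout.inl inr₁ x
  set rX := pushout.inr inr₁ x
  have hR' : IsPushout f₁ (a ≫ x₂) (inl₁ ≫ rP) rX := hax ▸ h₁.paste_vert hR
  let r' : M ⟶ pushout inr₁ x := hM.desc (inl₁ ≫ rP) (x₂ ≫ rX) (by simpa using hR'.w)
  have hr₁ : mB ≫ r' = inl₁ ≫ rP := hM.inl_desc _ _ _
  have hr₂ : mA ≫ r' = x₂ ≫ rX := hM.inr_desc _ _ _
  have hR'' : IsPushout mA x₂ r' rX := IsPushout.of_top (hr₁ ▸ hR') hr₂ hM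
  let r : pushout inr₁ x ⟶ P₂ := hR.desc p inr₂ hxp
  have hrP : rP ≫ r = p := hR.inl_desc _ _ _
  have hrX : rX ≫ r = inr₂ := hR.inr_desc _ _ _
  rw [← hrP]
  refine hQ.comp (hQ.cobase hR hinr₁ hx) (hQ.relative (inl' := inl₂) (inr' := inr₂) (n := n)
    hR'' (by rwa [hnA]) (IsWaldhausen.cof_cobaseChange hM hf₁) (by rwa [hnA]) hn ?_ hrX)
  apply hM.hom_ext
  · rw [reassoc_of% hr₁, hrP, hbp, reassoc_of% hnB]
  · rw [reassoc_of% hr₂, hrX, h₂.w.symm, reassoc_of% hnA]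

/-! ### Homotopy cocartesian squares -/

namespace Factorization

variable (D : W.Factorization)

/-- The square `A ⟶ B`, `A ⟶ X`, `B ⟶ P`, `X ⟶ P` has a weak w-cofibration `A ⟶ B`, and the map
`T ∪_A X ⟶ P` is a weak equivalence, where `A ⟶ T ⟶ B` is the functorial factorization. -/
def IsGood (sq : Square C) : Prop :=
  ∃ hf : W.weakCof sq.f₁₂, ∀ {P : C} {inl : D.mid hf ⟶ P} {inr : sq.X₃ ⟶ P} {c : P ⟶ sq.X₄},
    IsPushout (D.i hf) sq.f₁₃ inl inr → inl ≫ c = D.p hf ≫ sq.f₂₄ → inr ≫ c = sq.f₃₄ → W.weq c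

lemma isGood_iff {sq : Square C} (hf : W.weakCof sq.f₁₂)
    {P : C} {inl : D.mid hf ⟶ P} {inr : sq.X₃ ⟶ P} {c : P ⟶ sq.X₄}
    (h : IsPushout (D.i hf) sq.f₁₃ inl inr) (h₁ : inl ≫ c = D.p hf ≫ sq.f₂₄)
    (h₂ : inr ≫ c = sq.f₃₄) : D.IsGood sq ↔ W.weq c := by
  refine ⟨fun ⟨_, hP⟩ => hP h h₁ h₂, fun hc => ⟨hf, fun {P' inl' inr' c'} h' h₁' h₂' => ?_⟩⟩
  have : c' = h'.desc inl inr h.w ≫ c := by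
    apply h'.hom_ext <;> simp [h₁, h₂, h₁', h₂']
  rw [this]
  refine W.weq.comp_mem _ _ (IsWaldhausen.gluing (𝟙 _) (𝟙 _) (𝟙 _) _ h' h
    (D.cof_i hf) (D.cof_i hf) (by simp) (by simp) (by simp) (by simp) ?_ ?_ ?_) hc <;>
  exact W.weq.id_mem _

lemma exists_comparison {sq : Square C} (hf : W.weakCof sq.f₁₂) :
    ∃ (P : C) (inl : D.mid hf ⟶ P) (inr : sq.X₃ ⟶ P) (c : P ⟶ sq.X₄),
      IsPushout (D.i hf) sq.f₁₃ inl inr ∧ inl ≫ c = D.p hf ≫ sq.f₂₄ ∧ inr ≫ c = sq.f₃₄ := by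
  have := IsWaldhausen.hasPushout (D.i hf) sq.f₁₃ (D.cof_i hf)
  have h := IsPushout.of_hasPushout (D.i hf) sq.f₁₃
  have w : D.i hf ≫ D.p hf ≫ sq.f₂₄ = sq.f₁₃ ≫ sq.f₃₄ := by simp [sq.fac]
  exact ⟨_, _, _, h.desc _ _ w, h, h.inl_desc _ _ _, h.inr_desc _ _ _⟩

/-- A map of squares which is a weak equivalence on three corners induces a weak equivalence between
the pushouts by which `IsGood` is tested. -/
lemma exists_comparison_map [W.weq.HasTwoOutOfThreeProperty] {sq sq' : Square C} (φ : sq ⟶ sq')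
    (h₁ : W.weq φ.τ₁) (h₂ : W.weq φ.τ₂) (h₃ : W.weq φ.τ₃)
    (hf : W.weakCof sq.f₁₂) (hf' : W.weakCof sq'.f₁₂) :
    ∃ (P P' : C) (c : P ⟶ sq.X₄) (c' : P' ⟶ sq'.X₄) (p : P ⟶ P'),
      (D.IsGood sq ↔ W.weq c) ∧ (D.IsGood sq' ↔ W.weq c') ∧ W.weq p ∧ c ≫ φ.τ₄ = p ≫ c' := by
  obtain ⟨P, inl, inr, c, h, hl, hr⟩ := D.exists_comparison hf
  obtain ⟨P', inl', inr', c', h', hl', hr'⟩ := D.exists_comparison hf'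
  let t := D.map hf hf' φ.τ₁ φ.τ₂ φ.comm₁₂
  have hw : D.i hf ≫ t ≫ inl' = sq.f₁₃ ≫ φ.τ₃ ≫ inr' := by
    simp only [t, i_map_assoc, h'.w, Square.Hom.comm₁₃_assoc]
  let p : P ⟶ P' := h.desc (t ≫ inl') (φ.τ₃ ≫ inr') hw
  have ht : W.weq t := by
    refine W.weq.of_postcomp _ _ (D.weq_p hf') ?_
    rw [map_p]
    exact W.weq.comp_mem _ _ (D.weq_p hf) h₂
  refine ⟨P, P', c, c', p, D.isGood_iff hf h hl hr, D.isGood_iff hf' h' hl' hr',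
    IsWaldhausen.gluing φ.τ₁ t φ.τ₃ p h h' (D.cof_i hf) (D.cof_i hf') (i_map ..) φ.comm₁₃
      (h.inl_desc _ _ _) (h.inr_desc _ _ _) h₁ ht h₃, ?_⟩
  apply h.hom_ext
  · simp [p, reassoc_of% hl, hl', t, map_p_assoc]
  · simp [p, reassoc_of% hr, hr']

lemma isGood_of_isPushout {sq : Square C} (hsq : sq.IsPushout) (hf : W.weakCof sq.f₁₂)
    (h : W.cof sq.f₁₂ ∨ W.cof sq.f₁₃) : D.IsGood sq := by
  obtain ⟨P, inl, inr, c, h', hl, hr⟩ := D.exists_comparison hf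
  rw [D.isGood_iff hf h' hl hr]
  obtain h | h := h
  · exact IsWaldhausen.gluing (𝟙 _) (D.p hf) (𝟙 _) c h' hsq (D.cof_i hf) h (by simp) (by simp)
      hl (by simp [hr]) (W.weq.id_mem _) (D.weq_p hf) (W.weq.id_mem _)
  · exact IsWaldhausen.gluing (𝟙 _) (𝟙 _) (D.p hf) c h'.flip (IsPushout.flip hsq) h h
      (by simp) (by simp) (by simp [hr]) hl (W.weq.id_mem _) (W.weq.id_mem _) (D.weq_p hf)

section

variable [W.weq.HasTwoOutOfThreeProperty]

lemma isGood_iff_of_squareWeq {sq sq' : Square C} (φ : sq ⟶ sq')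
    (h : W.squareWeq φ) (hf : W.weakCof sq.f₁₂) (hf' : W.weakCof sq'.f₁₂) :
    D.IsGood sq ↔ D.IsGood sq' := by
  obtain ⟨P, P', c, c', p, e, e', hp, hc⟩ := D.exists_comparison_map φ h.1 h.2.1 h.2.2.1 hf hf'
  rw [e, e', ← W.weq.postcomp_iff c φ.τ₄ h.2.2.2, hc, W.weq.precomp_iff p c' hp]

/-- The two-out-of-three property for the fourth corner of a map of homotopy cocartesian squares. -/
lemma weq_of_isGood {sq sq' : Square C} (φ : sq ⟶ sq')
    (h₁ : W.weq φ.τ₁) (h₂ : W.weq φ.τ₂) (h₃ : W.weq φ.τ₃)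
    (h : D.IsGood sq) (h' : D.IsGood sq') : W.weq φ.τ₄ := by
  obtain ⟨P, P', c, c', p, e, e', hp, hc⟩ := D.exists_comparison_map φ h₁ h₂ h₃ h.1 h'.1
  rw [← W.weq.precomp_iff c φ.τ₄ (e.1 h), hc, W.weq.precomp_iff p c' hp]
  exact e'.1 h'

lemma isGood_of_isHomotopyCocartesian {sq : Square C} (h : W.IsHomotopyCocartesian sq)
    (hf : W.weakCof sq.f₁₂) : D.IsGood sq := by
  obtain ⟨sq', hsq', hc, hz⟩ := h
  have key : ∀ {sq sq' : Square C}, Zigzag W.squareWeq sq sq' →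
      ((W.weakCof sq.f₁₂ → D.IsGood sq) ↔ (W.weakCof sq'.f₁₂ → D.IsGood sq')) := by
    intro sq sq' hz
    induction hz with
    | rel x y h =>
      obtain ⟨φ, hφ⟩ := h
      have e := weakCof_iff_of_arrowWeq φ.τ₁ φ.τ₂ φ.comm₁₂ hφ.1 hφ.2.1
      exact ⟨fun k hy => (D.isGood_iff_of_squareWeq φ hφ (e.2 hy) hy).1 (k (e.2 hy)),
        fun k hx => (D.isGood_iff_of_squareWeq φ hφ hx (e.1 hx)).2 (k (e.1 hx))⟩
    | refl => rfl
    | symm _ _ _ ih => exact ih.symm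
    | trans _ _ _ _ _ ih ih' => exact ih.trans ih'
  exact (key hz).2 (fun hf' => D.isGood_of_isPushout hsq' hf' (hc.imp And.left And.left)) hf

end

end Factorization

end PreWaldhausen

/-! ### Pushouts of squares -/

section

variable {C : Type u} [Category.{v} C]

/-- Pushouts commute with pushouts: a pushout of pushout squares is a pushout square. -/
lemma isPushout_of_isPushout_corners {A B X P : Square C} {φ : A ⟶ B} {ψ : A ⟶ X} {β : B ⟶ P}
    {η : X ⟶ P} (h₂ : IsPushout φ.τ₂ ψ.τ₂ β.τ₂ η.τ₂)
    (h₃ : IsPushout φ.τ₃ ψ.τ₃ β.τ₃ η.τ₃) (h₄ : IsPushout φ.τ₄ ψ.τ₄ β.τ₄ η.τ₄)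
    (hA : A.IsPushout) (hB : B.IsPushout) (hX : X.IsPushout) : P.IsPushout := by
  have key : ∀ {Z : C} (a : P.X₂ ⟶ Z) (b : P.X₃ ⟶ Z), P.f₁₂ ≫ a = P.f₁₃ ≫ b →
      ∃ c : P.X₄ ⟶ Z, P.f₂₄ ≫ c = a ∧ P.f₃₄ ≫ c = b := by
    intro Z a b hab
    have wB : B.f₁₂ ≫ β.τ₂ ≫ a = B.f₁₃ ≫ β.τ₃ ≫ b := by
      rw [β.comm₁₂_assoc, hab, β.comm₁₃_assoc]
    have wX : X.f₁₂ ≫ η.τ₂ ≫ a = X.f₁₃ ≫ η.τ₃ ≫ b := by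
      rw [η.comm₁₂_assoc, hab, η.comm₁₃_assoc]
    have w₄ : φ.τ₄ ≫ hB.desc _ _ wB = ψ.τ₄ ≫ hX.desc _ _ wX := by
      apply hA.hom_ext
      · simp only [φ.comm₂₄_assoc, ψ.comm₂₄_assoc, hB.inl_desc, hX.inl_desc]
        rw [reassoc_of% h₂.w]
      · simp only [φ.comm₃₄_assoc, ψ.comm₃₄_assoc, hB.inr_desc, hX.inr_desc]
        rw [reassoc_of% h₃.w]
    refine ⟨h₄.desc _ _ w₄, ?_, ?_⟩
    · apply h₂.hom_ext
      · rw [← β.comm₂₄_assoc, h₄.inl_desc, hB.inl_desc]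
      · rw [← η.comm₂₄_assoc, h₄.inr_desc, hX.inl_desc]
    · apply h₃.hom_ext
      · rw [← β.comm₃₄_assoc, h₄.inl_desc, hB.inr_desc]
      · rw [← η.comm₃₄_assoc, h₄.inr_desc, hX.inr_desc]
  have ext : ∀ {Z : C} (c d : P.X₄ ⟶ Z), P.f₂₄ ≫ c = P.f₂₄ ≫ d → P.f₃₄ ≫ c = P.f₃₄ ≫ d →
      c = d := by
    intro Z c d h h'
    apply h₄.hom_ext
    · apply hB.hom_ext
      · simp only [β.comm₂₄_assoc, h]
      · simp only [β.comm₃₄_assoc, h']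
    · apply hX.hom_ext
      · simp only [η.comm₂₄_assoc, h]
      · simp only [η.comm₃₄_assoc, h']
  exact ⟨⟨P.fac⟩, ⟨PushoutCocone.IsColimit.mk P.fac
    (fun s => (key s.inl s.inr s.condition).choose)
    (fun s => (key s.inl s.inr s.condition).choose_spec.1)
    (fun s => (key s.inl s.inr s.condition).choose_spec.2)
    (fun s m h h' => ext _ _ (h.trans (key s.inl s.inr s.condition).choose_spec.1.symm)
      (h'.trans (key s.inl s.inr s.condition).choose_spec.2.symm))⟩⟩

end

namespace PreWaldhausen

variable {C : Type u} [Category.{v} C] {W : PreWaldhausen C} [W.IsWaldhausen]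

lemma exists_isPushout {A B X : C} {f : A ⟶ B} (hf : W.cof f) (g : A ⟶ X) :
    ∃ (P : C) (inl : B ⟶ P) (inr : X ⟶ P), IsPushout f g inl inr :=
  have := IsWaldhausen.hasPushout f g hf
  ⟨_, _, _, IsPushout.of_hasPushout f g⟩

/-- Let `A ⟶ B` and `A ⟶ X` be maps of homotopy cocartesian squares, such that the components of
`A ⟶ B` are w-cofibrations and `A₂ ∪_{A₁} B₁ ⟶ B₂` is a weak w-cofibration.  Then the pushout `P`
is homotopy cocartesian: replacing the horizontal arrows `A₁ ⟶ A₂`, `B₁ ⟶ B₂`, `X₁ ⟶ X₂` by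
w-cofibrations and all squares by pushouts changes `P` by a weak equivalence only, and makes it a
pushout. -/
lemma isHomotopyCocartesian_of_isPushout_corners [W.weq.HasTwoOutOfThreeProperty]
    (D : W.Factorization)
    {A B X P : Square C} {φ : A ⟶ B} {ψ : A ⟶ X} {β : B ⟶ P} {η : X ⟶ P}
    (h₁ : IsPushout φ.τ₁ ψ.τ₁ β.τ₁ η.τ₁) (h₂ : IsPushout φ.τ₂ ψ.τ₂ β.τ₂ η.τ₂)
    (h₃ : IsPushout φ.τ₃ ψ.τ₃ β.τ₃ η.τ₃) (h₄ : IsPushout φ.τ₄ ψ.τ₄ β.τ₄ η.τ₄)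
    (hφ₁ : W.cof φ.τ₁) (hφ₂ : W.cof φ.τ₂) (hφ₃ : W.cof φ.τ₃) (hφ₄ : W.cof φ.τ₄)
    (hA : D.IsGood A) (hB : D.IsGood B) (hX : D.IsGood X)
    {M : C} {inl : A.X₂ ⟶ M} {inr : B.X₁ ⟶ M} (hM : IsPushout A.f₁₂ φ.τ₁ inl inr) {n : M ⟶ B.X₂}
    (hn₁ : inl ≫ n = φ.τ₂) (hn₂ : inr ≫ n = B.f₁₂) (hn : W.weakCof n) :
    W.IsHomotopyCocartesian P := by
  obtain ⟨MT, mT, mB, hMT⟩ := exists_isPushout (D.cof_i hA.1) φ.τ₁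
  obtain ⟨e, he₁, he₂⟩ : ∃ e : MT ⟶ M, mT ≫ e = D.p hA.1 ≫ inl ∧ mB ≫ e = inr :=
    ⟨hMT.desc _ _ (by simp [hM.w]), hMT.inl_desc _ _ _, hMT.inr_desc _ _ _⟩
  have he : W.weq e := IsWaldhausen.gluing (𝟙 _) (𝟙 _) (D.p hA.1) e hMT.flip hM.flip hφ₁ hφ₁
    (by simp) (by simp) (by simp [he₂]) he₁ (W.weq.id_mem _) (W.weq.id_mem _) (D.weq_p _)
  have hen : W.weakCof (e ≫ n) :=
    (weakCof_iff_of_arrowWeq e (𝟙 _) (Category.comp_id _) he (W.weq.id_mem _)).2 hn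
  -- the replacement `B₁ ⟶ B'` of `B₁ ⟶ B₂`
  let j := D.i hen
  let q := D.p hen
  have hj : W.cof j := D.cof_i _
  have hjq : j ≫ q = e ≫ n := D.fac hen
  have hφ' : W.cof (mT ≫ j) := IsWaldhausen.cof_comp _ _ (cof_inl hMT hφ₁) hj
  have hb : W.cof (mB ≫ j) :=
    IsWaldhausen.cof_comp _ _ (IsWaldhausen.cof_cobaseChange hMT (D.cof_i _)) hj
  let t := D.map hA.1 hX.1 ψ.τ₁ ψ.τ₂ ψ.comm₁₂
  obtain ⟨P', pB, pT, hP'⟩ := exists_isPushout hφ' t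
  obtain ⟨k, hk₁, hk₂⟩ : ∃ k : P.X₁ ⟶ P', β.τ₁ ≫ k = mB ≫ j ≫ pB ∧ η.τ₁ ≫ k = D.i hX.1 ≫ pT := by
    have hw : φ.τ₁ ≫ mB ≫ j ≫ pB = ψ.τ₁ ≫ D.i hX.1 ≫ pT := by
      have := hP'.w
      rw [← reassoc_of% hMT.w]
      rw [Category.assoc] at this
      rw [this, D.i_map_assoc]
    exact ⟨h₁.desc _ _ hw, h₁.inl_desc _ _ _, h₁.inr_desc _ _ _⟩
  have hk : W.cof k :=
    cofClass_cof.pushout_map h₁ hP' hφ₁ hφ' (D.i hA.1) (mB ≫ j) (D.i hX.1) k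
      (D.i_map _ _ _ _ _).symm (by simp [hk₁]) hk₂ hMT.flip j rfl rfl hj (D.cof_i _)
  obtain ⟨r, hr₁, hr₂⟩ : ∃ r : P' ⟶ P.X₂, pB ≫ r = q ≫ β.τ₂ ∧ pT ≫ r = D.p hX.1 ≫ η.τ₂ := by
    have hw : (mT ≫ j) ≫ q ≫ β.τ₂ = t ≫ D.p hX.1 ≫ η.τ₂ := by
      rw [Category.assoc, reassoc_of% hjq, reassoc_of% he₁, reassoc_of% hn₁, D.map_p_assoc, h₂.w]
    exact ⟨hP'.desc _ _ hw, hP'.inl_desc _ _ _, hP'.inr_desc _ _ _⟩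
  have hr : W.weq r := IsWaldhausen.gluing (D.p hA.1) q (D.p hX.1) r hP' h₂ hφ' hφ₂
    (by rw [Category.assoc, hjq, reassoc_of% he₁, hn₁]) (D.map_p _ _ _ _ _) hr₁ hr₂ (D.weq_p _)
    (D.weq_p _) (D.weq_p _)
  -- the pushout squares which replace `A`, `B`, `X` and `P`
  obtain ⟨A₄, a₂, a₃, a₄, hA', ha₂, ha₃⟩ := D.exists_comparison hA.1
  obtain ⟨X₄, x₂, x₃, x₄, hX', hx₂, hx₃⟩ := D.exists_comparison hX.1
  obtain ⟨B₄, b₂, b₃, hB'⟩ := exists_isPushout hb B.f₁₃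
  obtain ⟨P₄, p₂, p₃, hP₄⟩ := exists_isPushout hk P.f₁₃
  have ha₄ : W.weq a₄ := hA.2 hA' ha₂ ha₃
  have hx₄ : W.weq x₄ := hX.2 hX' hx₂ hx₃
  have hbq : (mB ≫ j) ≫ q = B.f₁₂ := by rw [Category.assoc, hjq, reassoc_of% he₂, hn₂]
  have hkr : k ≫ r = P.f₁₂ := by
    apply h₁.hom_ext
    · rw [reassoc_of% hk₁, hr₁, ← β.comm₁₂, ← hbq]; simp
    · rw [reassoc_of% hk₂, hr₂, D.fac_assoc, η.comm₁₂]
  obtain ⟨b₄, hb₂, hb₃⟩ : ∃ b₄ : B₄ ⟶ B.X₄, b₂ ≫ b₄ = q ≫ B.f₂₄ ∧ b₃ ≫ b₄ = B.f₃₄ :=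
    ⟨hB'.desc _ _ (by rw [← Category.assoc, hbq, B.fac]), hB'.inl_desc _ _ _, hB'.inr_desc _ _ _⟩
  obtain ⟨p₄, hp₂, hp₃⟩ : ∃ p₄ : P₄ ⟶ P.X₄, p₂ ≫ p₄ = r ≫ P.f₂₄ ∧ p₃ ≫ p₄ = P.f₃₄ :=
    ⟨hP₄.desc _ _ (by rw [← Category.assoc, hkr, P.fac]), hP₄.inl_desc _ _ _, hP₄.inr_desc _ _ _⟩
  let A' : Square C := ⟨D.i hA.1, A.f₁₃, a₂, a₃, hA'.w⟩
  let B' : Square C := ⟨mB ≫ j, B.f₁₃, b₂, b₃, hB'.w⟩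
  let X' : Square C := ⟨D.i hX.1, X.f₁₃, x₂, x₃, hX'.w⟩
  let Q' : Square C := ⟨k, P.f₁₃, p₂, p₃, hP₄.w⟩
  have hb₄ : W.weq b₄ := by
    let ρ : B' ⟶ B := ⟨𝟙 _, q, 𝟙 _, b₄, by simp [B', hjq, reassoc_of% he₂, hn₂], by simp [B'], hb₂,
      by simp [B', hb₃]⟩
    exact D.weq_of_isGood ρ (W.weq.id_mem _) (D.weq_p _) (W.weq.id_mem _)
      (D.isGood_of_isPushout hB' (W.weakCof_of_cof _ hb) (Or.inl hb)) hB
  -- the induced maps on the fourth corners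
  obtain ⟨φ₄, hφ₄₁, hφ₄₂⟩ : ∃ φ₄ : A₄ ⟶ B₄, a₂ ≫ φ₄ = (mT ≫ j) ≫ b₂ ∧ a₃ ≫ φ₄ = φ.τ₃ ≫ b₃ := by
    have hw : D.i hA.1 ≫ (mT ≫ j) ≫ b₂ = A.f₁₃ ≫ φ.τ₃ ≫ b₃ := by
      have := hB'.w
      simp only [Category.assoc] at this ⊢
      rw [reassoc_of% hMT.w, this, φ.comm₁₃_assoc]
    exact ⟨hA'.desc _ _ hw, hA'.inl_desc _ _ _, hA'.inr_desc _ _ _⟩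
  obtain ⟨ψ₄, hψ₄₁, hψ₄₂⟩ : ∃ ψ₄ : A₄ ⟶ X₄, a₂ ≫ ψ₄ = t ≫ x₂ ∧ a₃ ≫ ψ₄ = ψ.τ₃ ≫ x₃ :=
    ⟨hA'.desc _ _ (by rw [D.i_map_assoc, hX'.w, ψ.comm₁₃_assoc]), hA'.inl_desc _ _ _,
      hA'.inr_desc _ _ _⟩
  obtain ⟨β₄, hβ₄₁, hβ₄₂⟩ : ∃ β₄ : B₄ ⟶ P₄, b₂ ≫ β₄ = pB ≫ p₂ ∧ b₃ ≫ β₄ = β.τ₃ ≫ p₃ := by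
    have hw : (mB ≫ j) ≫ pB ≫ p₂ = B.f₁₃ ≫ β.τ₃ ≫ p₃ := by
      simp only [Category.assoc]
      rw [← reassoc_of% hk₁, hP₄.w, β.comm₁₃_assoc]
    exact ⟨hB'.desc _ _ hw, hB'.inl_desc _ _ _, hB'.inr_desc _ _ _⟩
  obtain ⟨η₄, hη₄₁, hη₄₂⟩ : ∃ η₄ : X₄ ⟶ P₄, x₂ ≫ η₄ = pT ≫ p₂ ∧ x₃ ≫ η₄ = η.τ₃ ≫ p₃ := by
    have hw : D.i hX.1 ≫ pT ≫ p₂ = X.f₁₃ ≫ η.τ₃ ≫ p₃ := by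
      rw [← reassoc_of% hk₂, hP₄.w, η.comm₁₃_assoc]
    exact ⟨hX'.desc _ _ hw, hX'.inl_desc _ _ _, hX'.inr_desc _ _ _⟩
  have hφ₄' : W.cof φ₄ := cofClass_cof.pushout_map hA' hB' (D.cof_i _) hb φ.τ₁ (mT ≫ j) φ.τ₃ φ₄
    φ.comm₁₃ hφ₄₁ hφ₄₂ hMT j rfl rfl hj hφ₃
  have hK₄w : φ₄ ≫ β₄ = ψ₄ ≫ η₄ := by
    apply hA'.hom_ext
    · rw [reassoc_of% hφ₄₁, reassoc_of% hψ₄₁, hβ₄₁, hη₄₁]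
      simpa only [Category.assoc] using hP'.w_assoc p₂
    · rw [reassoc_of% hφ₄₂, reassoc_of% hψ₄₂, hβ₄₂, hη₄₂, h₃.w_assoc]
  let K₁ : Square C := ⟨φ.τ₁, ψ.τ₁, β.τ₁, η.τ₁, h₁.w⟩
  let K₂ : Square C := ⟨mT ≫ j, t, pB, pT, hP'.w⟩
  let K₃ : Square C := ⟨φ.τ₃, ψ.τ₃, β.τ₃, η.τ₃, h₃.w⟩
  let K₄ : Square C := ⟨φ₄, ψ₄, β₄, η₄, hK₄w⟩
  have hK₄ : K₄.IsPushout := isPushout_of_isPushout_corners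
    (A := K₁) (B := K₂) (X := K₃) (P := K₄)
    (φ := ⟨D.i hA.1, mB ≫ j, D.i hX.1, k, by simp [K₁, K₂, ← hMT.w_assoc],
      (D.i_map hA.1 hX.1 _ _ ψ.comm₁₂).symm, by simp [K₁, K₂, hk₁], hk₂⟩)
    (ψ := ⟨A.f₁₃, B.f₁₃, X.f₁₃, P.f₁₃, φ.comm₁₃.symm, ψ.comm₁₃.symm, β.comm₁₃.symm,
      η.comm₁₃.symm⟩)
    (β := ⟨a₂, b₂, x₂, p₂, hφ₄₁.symm, hψ₄₁.symm, hβ₄₁.symm, hη₄₁.symm⟩)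
    (η := ⟨a₃, b₃, x₃, p₃, hφ₄₂.symm, hψ₄₂.symm, hβ₄₂.symm, hη₄₂.symm⟩)
    hB' hX' hP₄ h₁ hP' h₃
  have hp₄ : W.weq p₄ := by
    refine IsWaldhausen.gluing a₄ b₄ x₄ p₄ hK₄ h₄ hφ₄' hφ₄ ?_ ?_ ?_ ?_ ha₄ hb₄ hx₄
    · apply hA'.hom_ext
      · rw [reassoc_of% hφ₄₁, hb₂, reassoc_of% ha₂, φ.comm₂₄]
        simp only [reassoc_of% hjq, reassoc_of% he₁, reassoc_of% hn₁]
      · rw [reassoc_of% hφ₄₂, hb₃, reassoc_of% ha₃, φ.comm₃₄]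
    · apply hA'.hom_ext
      · rw [reassoc_of% hψ₄₁, hx₂, reassoc_of% ha₂, ψ.comm₂₄, D.map_p_assoc]
      · rw [reassoc_of% hψ₄₂, hx₃, reassoc_of% ha₃, ψ.comm₃₄]
    · apply hB'.hom_ext
      · rw [reassoc_of% hβ₄₁, hp₂, reassoc_of% hb₂, β.comm₂₄, reassoc_of% hr₁]
      · rw [reassoc_of% hβ₄₂, hp₃, reassoc_of% hb₃, β.comm₃₄]
    · apply hX'.hom_ext
      · rw [reassoc_of% hη₄₁, hp₂, reassoc_of% hx₂, η.comm₂₄, reassoc_of% hr₂]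
      · rw [reassoc_of% hη₄₂, hp₃, reassoc_of% hx₃, η.comm₃₄]
  let ρ : Q' ⟶ P := ⟨𝟙 _, r, 𝟙 _, p₄, by simp [Q', hkr], by simp [Q'], hp₂, by simp [Q', hp₃]⟩
  rw [← isHomotopyCocartesian_iff_of_squareWeq ρ ⟨W.weq.id_mem _, hr, W.weq.id_mem _, hp₄⟩]
  exact ⟨Q', hP₄, Or.inl ⟨hk, IsWaldhausen.cof_cobaseChange hP₄ hk⟩, Relation.EqvGen.refl _⟩

end PreWaldhausen

/-! ### Pointwise pushouts of diagrams -/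

section

variable {J : Type u₁} [Category.{v₁} J] {C : Type u} [Category.{v} C]

lemma exists_isPushout_app {A B X : J ⥤ C} (f : A ⟶ B) (g : A ⟶ X)
    (h : ∀ j, HasPushout (f.app j) (g.app j)) :
    ∃ (P : J ⥤ C) (inl : B ⟶ P) (inr : X ⟶ P),
      ∀ j, IsPushout (f.app j) (g.app j) (inl.app j) (inr.app j) := by
  have hP : ∀ j, ∃ (P : C) (inl : B.obj j ⟶ P) (inr : X.obj j ⟶ P),
      IsPushout (f.app j) (g.app j) inl inr := fun j => ⟨_, _, _, IsPushout.of_hasPushout _ _⟩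
  choose P inl inr hP using hP
  have hw : ∀ {i j : J} (α : i ⟶ j), f.app i ≫ B.map α ≫ inl j = g.app i ≫ X.map α ≫ inr j := by
    intro i j α
    rw [← f.naturality_assoc, ← g.naturality_assoc, (hP j).w]
  refine ⟨{ obj := P
            map {i j} α := (hP i).desc (B.map α ≫ inl j) (X.map α ≫ inr j) (hw α)
            map_id j := by apply (hP j).hom_ext <;> simp
            map_comp {i j k} α β := by apply (hP i).hom_ext <;> simp }, ⟨inl, ?_⟩, ⟨inr, ?_⟩, hP⟩
  · intro i j α
    exact ((hP i).inl_desc _ _ _).symm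
  · intro i j α
    exact ((hP i).inr_desc _ _ _).symm

/-- If the pointwise pushouts exist, every pushout of functors is pointwise. -/
lemma isPushout_app {A B X P : J ⥤ C} {f : A ⟶ B} {g : A ⟶ X} {inl : B ⟶ P} {inr : X ⟶ P}
    (hP : IsPushout f g inl inr) (h : ∀ j, HasPushout (f.app j) (g.app j)) (j : J) :
    IsPushout (f.app j) (g.app j) (inl.app j) (inr.app j) := by
  obtain ⟨P', inl', inr', h'⟩ := exists_isPushout_app f g h
  let e := (IsPushout.of_forall_isPushout_app h').isoIsPushout _ _ hP
  refine (h' j).of_iso (Iso.refl _) (Iso.refl _) (Iso.refl _) (e.app j) (by simp) (by simp) ?_ ?_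
  · simp only [e, Iso.app_hom, ← NatTrans.comp_app, IsPushout.inl_isoIsPushout_hom]
    simp
  · simp only [e, Iso.app_hom, ← NatTrans.comp_app, IsPushout.inr_isoIsPushout_hom]
    simp

/-- A pushout in the ambient category which is isomorphic to an object of a full subcategory gives
all the pushouts of the span in the full subcategory. -/
lemma isPushout_ι_of_isPushout {D : Type u₂} [Category.{v₂} D] {p : ObjectProperty D}
    {A B X P : p.FullSubcategory} {f : A ⟶ B}
    {g : A ⟶ X} {inl : B ⟶ P} {inr : X ⟶ P} (h : IsPushout f g inl inr) {P' : D}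
    {inl' : B.obj ⟶ P'} {inr' : X.obj ⟶ P'} (h' : IsPushout f.hom g.hom inl' inr')
    {P'' : D} (hP'' : p P'') (e : P' ≅ P'') :
    IsPushout f.hom g.hom inl.hom inr.hom := by
  have h₁ : IsPushout f.hom g.hom (inl' ≫ e.hom) (inr' ≫ e.hom) :=
    h'.of_iso (Iso.refl _) (Iso.refl _) (Iso.refl _) e (by simp) (by simp) (by simp) (by simp)
  let Q : p.FullSubcategory := ⟨P'', hP''⟩
  have h₂ : IsPushout f g (⟨inl' ≫ e.hom⟩ : B ⟶ Q) (⟨inr' ≫ e.hom⟩ : X ⟶ Q) :=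
    IsPushout.of_map p.ι (ObjectProperty.hom_ext _ h₁.w) h₁
  let e' := h₂.isoIsPushout _ _ h
  refine h₁.of_iso (Iso.refl _) (Iso.refl _) (Iso.refl _) (p.ι.mapIso e') (by simp) (by simp) ?_ ?_
  · exact (congrArg (fun k => k.hom) (h₂.inl_isoIsPushout_hom _ _ h)).trans
      (Category.id_comp _).symm
  · exact (congrArg (fun k => k.hom) (h₂.inr_isoIsPushout_hom _ _ h)).trans
      (Category.id_comp _).symm

end

/-! ### W-cofibrations of diagrams indexed by `Ar[n]` -/

section

variable {C : Type u} [Category.{v} C] {n : SimplexCategory}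

lemma arCof_iff {P Q : MorphismProperty C} {A B : Ar n ⥤ C} {τ : A ⟶ B} :
    arCof P Q n τ ↔ (∀ (i j : Fin (n.len + 1)) (hij : i ≤ j), P (arApp τ hij)) ∧
      ∀ (i j k : Fin (n.len + 1)) (hij : i ≤ j) (hjk : j ≤ k) (X : C)
        (inl : arObj A (hij.trans hjk) ⟶ X) (inr : arObj B hij ⟶ X)
        (m : X ⟶ arObj B (hij.trans hjk)),
        IsPushout (arHom A hij (hij.trans hjk) le_rfl hjk) (arApp τ hij) inl inr →
        inl ≫ m = arApp τ (hij.trans hjk) →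
        inr ≫ m = arHom B hij (hij.trans hjk) le_rfl hjk → Q m := by
  refine and_congr Iff.rfl ⟨fun h i j k hij hjk X inl inr m hX h₁ h₂ => ?_,
    fun h i j k hij hjk X inl inr hX => ?_⟩
  · have := h i j k hij hjk X inl inr hX
    rwa [show m = hX.desc _ _ (τ.naturality _) from hX.hom_ext (by simp [h₁]) (by simp [h₂])]
  · exact h i j k hij hjk X inl inr _ hX (by simp) (by simp)

/-- The map of squares given by a natural transformation. -/
@[simps]
def arSquareMap {A B : Ar n ⥤ C} (τ : A ⟶ B) {i j k : Fin (n.len + 1)} (hij : i ≤ j)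
    (hjk : j ≤ k) : arSquare A hij hjk ⟶ arSquare B hij hjk where
  τ₁ := arApp τ hij
  τ₂ := arApp τ (hij.trans hjk)
  τ₃ := arApp τ le_rfl
  τ₄ := arApp τ hjk
  comm₁₂ := τ.naturality _
  comm₁₃ := τ.naturality _
  comm₂₄ := τ.naturality _
  comm₃₄ := τ.naturality _

end

namespace PreWaldhausen

variable {C : Type u} [Category.{v} C] {W : PreWaldhausen C} [W.IsWaldhausen]

lemma isIso_of_isZero {X Y : C} (hX : IsZero X) (hY : IsZero Y) (f : X ⟶ Y) : IsIso f :=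
  isIso_of_isInitial hX.isInitial hY.isInitial f

lemma cof_of_isZero {X Y : C} (hX : IsZero X) (f : X ⟶ Y) : W.cof f := by
  let e := (IsWaldhausen.isZero_pt (W := W)).iso hX
  have := IsWaldhausen.cof_comp (W := W) e.inv (e.hom ≫ f)
    (IsWaldhausen.cof_of_isIso _ inferInstance) (IsWaldhausen.cof_from_pt _)
  simpa using this

namespace CofClass

variable {n : SimplexCategory} {Q : MorphismProperty C} (hQ : CofClass W Q)

include hQ

/-- The latching map of `τ ≫ σ` is a cobase change of that of `τ` followed by that of `σ`. -/
lemma arCof_comp {A B E : Ar n ⥤ C} {τ : A ⟶ B} {σ : B ⟶ E} (hτ : arCof W.cof Q n τ)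
    (hσ : arCof W.cof Q n σ) : arCof W.cof Q n (τ ≫ σ) := by
  rw [arCof_iff] at hτ hσ ⊢
  refine ⟨fun i j hij => IsWaldhausen.cof_comp _ _ (hτ.1 i j hij) (hσ.1 i j hij), ?_⟩
  intro i j k hij hjk N inl inr m hN h₁ h₂
  -- the two latching objects of `τ` and `σ`
  obtain ⟨M, mr, ml, hM⟩ := exists_isPushout (hτ.1 i j hij) (arHom A hij (hij.trans hjk) le_rfl hjk)
  obtain ⟨a, ha₁, ha₂⟩ : ∃ a : M ⟶ arObj B (hij.trans hjk),
      mr ≫ a = arHom B hij (hij.trans hjk) le_rfl hjk ∧ ml ≫ a = arApp τ (hij.trans hjk) :=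
    ⟨hM.desc _ _ (τ.naturality _).symm, hM.inl_desc _ _ _, hM.inr_desc _ _ _⟩
  have ha : Q a := hτ.2 i j k hij hjk M ml mr a hM.flip ha₂ ha₁
  have hN' : IsPushout (arApp τ hij ≫ arApp σ hij) (arHom A hij (hij.trans hjk) le_rfl hjk)
      inr inl :=
    hN.flip
  obtain ⟨b, hb₁, hb₂⟩ : ∃ b : M ⟶ N, mr ≫ b = arApp σ hij ≫ inr ∧ ml ≫ b = inl :=
    ⟨hM.desc _ _ (by rw [← hN'.w, Category.assoc]), hM.inl_desc _ _ _, hM.inr_desc _ _ _⟩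
  have hb : IsPushout (arApp σ hij) mr inr b :=
    IsPushout.of_left (h₁₁ := arApp τ hij) (by rwa [hb₂]) hb₁.symm hM
  have hb' : W.cof b := IsWaldhausen.cof_cobaseChange hb (hσ.1 i j hij)
  obtain ⟨N', l, r, hN''⟩ := exists_isPushout hb' a
  have hN₃ : IsPushout (arApp σ hij) (arHom B hij (hij.trans hjk) le_rfl hjk) (inr ≫ l) r :=
    ha₁ ▸ hb.paste_vert hN''
  obtain ⟨m', hm₁, hm₂⟩ : ∃ m' : N' ⟶ arObj E (hij.trans hjk), l ≫ m' = m ∧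
      r ≫ m' = arApp σ (hij.trans hjk) := by
    refine ⟨hN''.desc _ _ ?_, hN''.inl_desc _ _ _, hN''.inr_desc _ _ _⟩
    apply hM.hom_ext
    · rw [reassoc_of% hb₁, h₂, reassoc_of% ha₁]
      exact (σ.naturality _).symm
    · rw [reassoc_of% hb₂, h₁, reassoc_of% ha₂]
      rfl
  rw [← hm₁]
  exact hQ.comp (hQ.cobase hN'' hb' ha)
    (hσ.2 i j k hij hjk N' r (inr ≫ l) m' hN₃.flip hm₂ (by rw [Category.assoc, hm₁, h₂]))

lemma arCof_of_isIso {A B : Ar n ⥤ C} (τ : A ⟶ B) [IsIso τ] : arCof W.cof Q n τ := by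
  rw [arCof_iff]
  refine ⟨fun i j hij => IsWaldhausen.cof_of_isIso _ inferInstance, ?_⟩
  intro i j k hij hjk N inl inr m hN h₁ h₂
  have : IsIso inl := hN.isIso_inl_of_isIso
  have : m = inv inl ≫ arApp τ (hij.trans hjk) := by rw [← h₁, IsIso.inv_hom_id_assoc]
  rw [this]
  exact hQ.of_isIso _ inferInstance

lemma arCof_of_isZero {A B : Ar n ⥤ C} (τ : A ⟶ B) (hA : ∀ x, IsZero (A.obj x))
    (hB : ∀ (i j k : Fin (n.len + 1)) (hij : i ≤ j) (hjk : j ≤ k),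
      Q (arHom B hij (hij.trans hjk) le_rfl hjk)) : arCof W.cof Q n τ := by
  rw [arCof_iff]
  refine ⟨fun i j hij => cof_of_isZero (hA _) _, ?_⟩
  intro i j k hij hjk N inl inr m hN h₁ h₂
  have := isIso_of_isZero (hA _) (hA _) (arHom A hij (hij.trans hjk) le_rfl hjk)
  have : IsIso inr := hN.isIso_inr_of_isIso
  have : m = inv inr ≫ arHom B hij (hij.trans hjk) le_rfl hjk := by
    rw [← h₂, IsIso.inv_hom_id_assoc]
  rw [this]
  exact hQ.comp (hQ.of_isIso _ inferInstance) (hB i j k hij hjk)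

/-- With `M = A_{i,k} ∪_{A_{i,j}} B_{i,j}`, the latching map of `X ⟶ P` is the map
`M ∪_{A_{i,k}} X_{i,k} ⟶ B_{i,k} ∪_{A_{i,k}} X_{i,k}`. -/
lemma arCof_cobaseChange {A B X P : Ar n ⥤ C} {f : A ⟶ B} {g : A ⟶ X} {inl : B ⟶ P} {inr : X ⟶ P}
    (h : ∀ x, IsPushout (f.app x) (g.app x) (inl.app x) (inr.app x))
    (hf : arCof W.cof Q n f) : arCof W.cof Q n inr := by
  rw [arCof_iff] at hf ⊢
  refine ⟨fun i j hij => IsWaldhausen.cof_cobaseChange (h _) (hf.1 i j hij), ?_⟩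
  intro i j k hij hjk N nX nP r hN h₁ h₂
  obtain ⟨M, mB, mA, hM⟩ := exists_isPushout (hf.1 i j hij) (arHom A hij (hij.trans hjk) le_rfl hjk)
  obtain ⟨a, ha₁, ha₂⟩ : ∃ a : M ⟶ arObj B (hij.trans hjk),
      mB ≫ a = arHom B hij (hij.trans hjk) le_rfl hjk ∧ mA ≫ a = arApp f (hij.trans hjk) :=
    ⟨hM.desc _ _ (f.naturality _).symm, hM.inl_desc _ _ _, hM.inr_desc _ _ _⟩
  have ha : Q a := hf.2 i j k hij hjk M mA mB a hM.flip ha₂ ha₁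
  have hN' : IsPushout (arApp f hij) (arHom A hij (hij.trans hjk) le_rfl hjk ≫
      arApp g (hij.trans hjk)) (arApp inl hij ≫ nP) nX := by
    rw [show arHom A hij (hij.trans hjk) le_rfl hjk ≫ arApp g (hij.trans hjk) = _ from
      g.naturality _]
    exact (h ⟨(i, j), hij⟩).paste_vert hN.flip
  obtain ⟨b, hb₁, hb₂⟩ : ∃ b : M ⟶ N, mB ≫ b = arApp inl hij ≫ nP ∧
      mA ≫ b = arApp g (hij.trans hjk) ≫ nX :=
    ⟨hM.desc _ _ (by rw [hN'.w, Category.assoc]), hM.inl_desc _ _ _, hM.inr_desc _ _ _⟩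
  have hb : IsPushout mA (arApp g (hij.trans hjk)) b nX :=
    IsPushout.of_top (v₁₁ := arHom A hij (hij.trans hjk) le_rfl hjk) (by rwa [hb₁]) hb₂ hM
  refine hQ.relative (n := a) (inl' := arApp inl (hij.trans hjk))
    (inr' := arApp inr (hij.trans hjk)) hb (by rw [ha₂]; exact h _)
    (IsWaldhausen.cof_cobaseChange hM (hf.1 i j hij))
    (by rw [ha₂]; exact hf.1 i k _) ha ?_ h₁
  apply hM.hom_ext
  · rw [reassoc_of% hb₁, h₂, reassoc_of% ha₁]
    exact (inl.naturality _).symm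
  · rw [reassoc_of% hb₂, h₁, reassoc_of% ha₂]
    exact (h ⟨(i, k), hij.trans hjk⟩).w.symm

/-- The horizontal maps of a pushout of diagrams along a w-cofibration. -/
lemma arHom_of_isPushout {A B X P : Ar n ⥤ C} {f : A ⟶ B} {g : A ⟶ X} {inl : B ⟶ P} {inr : X ⟶ P}
    (h : ∀ x, IsPushout (f.app x) (g.app x) (inl.app x) (inr.app x))
    (hf : arCof W.cof Q n f) {i j k : Fin (n.len + 1)} (hij : i ≤ j) (hjk : j ≤ k)
    (hX : Q (arHom X hij (hij.trans hjk) le_rfl hjk)) :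
    Q (arHom P hij (hij.trans hjk) le_rfl hjk) := by
  rw [arCof_iff] at hf
  obtain ⟨M, mB, mA, hM⟩ := exists_isPushout (hf.1 i j hij) (arHom A hij (hij.trans hjk) le_rfl hjk)
  obtain ⟨a, ha₁, ha₂⟩ : ∃ a : M ⟶ arObj B (hij.trans hjk),
      mB ≫ a = arHom B hij (hij.trans hjk) le_rfl hjk ∧ mA ≫ a = arApp f (hij.trans hjk) :=
    ⟨hM.desc _ _ (f.naturality _).symm, hM.inl_desc _ _ _, hM.inr_desc _ _ _⟩
  have ha : Q a := hf.2 i j k hij hjk M mA mB a hM.flip ha₂ ha₁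
  exact hQ.pushout_map (h _) (h _) (hf.1 i j hij) (hf.1 i k _) _ _ _ _ (g.naturality _).symm
    (inl.naturality _).symm (inr.naturality _).symm hM a ha₁ ha₂ ha hX

end CofClass

lemma hasPushout_app {n : SimplexCategory} {Q : MorphismProperty C} {A B X : Ar n ⥤ C}
    {f : A ⟶ B} (g : A ⟶ X) (hf : arCof W.cof Q n f) (x : Ar n) :
    HasPushout (f.app x) (g.app x) :=
  IsWaldhausen.hasPushout _ _ (hf.1 x.1.1 x.1.2 x.2)

/-- A class of diagrams which is closed under pushouts along w-cofibrations, up to isomorphism. -/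
def ClosedUnderPushouts (W : PreWaldhausen C) (n : SimplexCategory) (Q : MorphismProperty C)
    (p : ObjectProperty (Ar n ⥤ C)) : Prop :=
  ∀ {A B X P : Ar n ⥤ C} {f : A ⟶ B} {g : A ⟶ X} {inl : B ⟶ P} {inr : X ⟶ P},
    (∀ x, IsPushout (f.app x) (g.app x) (inl.app x) (inr.app x)) → arCof W.cof Q n f →
    p A → p B → p X → ∃ P', p P' ∧ Nonempty (P ≅ P')

namespace ClosedUnderPushouts

variable {n : SimplexCategory} {Q : MorphismProperty C} {p : ObjectProperty (Ar n ⥤ C)}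
  (hp : ClosedUnderPushouts W n Q p)

include hp

lemma isPushout_app {A B X P : p.FullSubcategory} {f : A ⟶ B} {g : A ⟶ X} {inl : B ⟶ P}
    {inr : X ⟶ P} (h : IsPushout f g inl inr) (hf : arCof W.cof Q n f.hom) (x : Ar n) :
    IsPushout (f.hom.app x) (g.hom.app x) (inl.hom.app x) (inr.hom.app x) := by
  obtain ⟨P', inl', inr', h'⟩ := exists_isPushout_app f.hom g.hom (hasPushout_app _ hf)
  obtain ⟨P'', hP'', ⟨e⟩⟩ := hp h' hf A.property B.property X.property
  exact WaldhausenK.isPushout_app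
    (isPushout_ι_of_isPushout h (IsPushout.of_forall_isPushout_app h') hP'' e)
    (hasPushout_app _ hf) x

/-- The axioms of a Waldhausen category for a full subcategory of the category of diagrams indexed
by `Ar[n]` which is closed under pushouts along w-cofibrations. -/
theorem isWaldhausen (hQ : CofClass W Q) (hp' : ∀ A, p A →
      ∀ (i j k : Fin (n.len + 1)) (hij : i ≤ j) (hjk : j ≤ k),
        Q (arHom A hij (hij.trans hjk) le_rfl hjk))
    (V : PreWaldhausen p.FullSubcategory) (hV₀ : ∀ x, IsZero (V.pt.obj.obj x))
    (hV₁ : V.cof = (arCof W.cof Q n).inverseImage p.ι)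
    (hV₂ : V.weq = (W.levelWeq n).inverseImage p.ι) : V.IsWaldhausen where
  isZero_pt :=
    { unique_to Y := ⟨⟨⟨⟨{ app x := (hV₀ x).to_ _, naturality _ _ _ := (hV₀ _).eq_of_src _ _ }⟩⟩,
        fun f => by ext x; exact (hV₀ x).eq_of_src _ _⟩⟩
      unique_from Y := ⟨⟨⟨⟨{ app x := (hV₀ x).from_ _,
                             naturality _ _ _ := (hV₀ _).eq_of_tgt _ _ }⟩⟩,
        fun f => by ext x; exact (hV₀ x).eq_of_tgt _ _⟩⟩ }
  cof_comp f g hf hg := by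
    rw [hV₁] at hf hg ⊢
    exact hQ.arCof_comp hf hg
  cof_of_isIso f hf := by
    rw [hV₁]
    have : IsIso f.hom := inferInstanceAs (IsIso (p.ι.map f))
    exact hQ.arCof_of_isIso f.hom
  cof_from_pt {X} f := by
    rw [hV₁]
    exact hQ.arCof_of_isZero f.hom hV₀ (hp' _ X.property)
  hasPushout {A B X} f g hf := by
    rw [hV₁] at hf
    obtain ⟨P', inl', inr', h'⟩ := exists_isPushout_app f.hom g.hom (hasPushout_app _ hf)
    obtain ⟨P'', hP'', ⟨e⟩⟩ := hp h' hf A.property B.property X.property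
    have h₁ : IsPushout f.hom g.hom (inl' ≫ e.hom) (inr' ≫ e.hom) :=
      (IsPushout.of_forall_isPushout_app h').of_iso (Iso.refl _) (Iso.refl _) (Iso.refl _) e
        (by simp) (by simp) (by simp) (by simp)
    let P : p.FullSubcategory := ⟨P'', hP''⟩
    have h₂ : IsPushout f g (⟨inl' ≫ e.hom⟩ : B ⟶ P) (⟨inr' ≫ e.hom⟩ : X ⟶ P) :=
      IsPushout.of_map p.ι (ObjectProperty.hom_ext _ h₁.w) h₁
    exact h₂.hasPushout
  cof_cobaseChange h hf := by
    rw [hV₁] at hf ⊢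
    exact hQ.arCof_cobaseChange (hp.isPushout_app h hf) hf
  weq_of_isIso f hf := by
    rw [hV₂]
    have : IsIso f.hom := inferInstanceAs (IsIso (p.ι.map f))
    exact fun x => IsWaldhausen.weq_of_isIso _ inferInstance
  gluing a b x q h h' hf hf' h₁ h₂ h₃ h₄ ha hb hx := by
    rw [hV₁] at hf hf'
    rw [hV₂] at ha hb hx ⊢
    intro y
    have e : ∀ {A B : p.FullSubcategory} {s t : A ⟶ B}, s = t → s.hom.app y = t.hom.app y := by
      rintro _ _ _ _ rfl; rfl
    exact IsWaldhausen.gluing (a.hom.app y) (b.hom.app y) (x.hom.app y) (q.hom.app y)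
      (hp.isPushout_app h hf y) (hp.isPushout_app h' hf' y) (hf.1 _ _ _) (hf'.1 _ _ _)
      (e h₁) (e h₂) (e h₃) (e h₄) (ha y) (hb y) (hx y)

end ClosedUnderPushouts

end PreWaldhausen

namespace PreWaldhausen

variable {C : Type u} [Category.{v} C] {W : PreWaldhausen C} [W.IsWaldhausen]

/-! ### The Waldhausen categories `S_n C` and `S'_n C` -/

lemma cof_iff_of_iso {A B A' B' : C} {f : A ⟶ B} {f' : A' ⟶ B'} (a : A ≅ A') (b : B ≅ B')
    (h : f ≫ b.hom = a.hom ≫ f') : W.cof f ↔ W.cof f' := by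
  constructor
  · intro hf
    have := IsWaldhausen.cof_comp (W := W) _ _ (IsWaldhausen.cof_of_isIso a.inv inferInstance)
      (IsWaldhausen.cof_comp _ _ hf (IsWaldhausen.cof_of_isIso b.hom inferInstance))
    simpa [h] using this
  · intro hf
    have := IsWaldhausen.cof_comp (W := W) _ _ (IsWaldhausen.cof_of_isIso a.hom inferInstance)
      (IsWaldhausen.cof_comp _ _ hf (IsWaldhausen.cof_of_isIso b.inv inferInstance))
    simpa [← reassoc_of% h] using this

variable (W) in
/-- The diagrams isomorphic to an object of `S_n C`: the diagonal entries `A_{i,i}` are zero objects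
but not necessarily the distinguished one. -/
def sObjIso (n : SimplexCategory) : ObjectProperty (Ar n ⥤ C) := fun A =>
  (∀ i : Fin (n.len + 1), IsZero (arObj A (le_refl i))) ∧
  (∀ (i j k : Fin (n.len + 1)) (hij : i ≤ j) (hjk : j ≤ k),
    W.cof (arHom A hij (hij.trans hjk) le_rfl hjk)) ∧
  (∀ (i j k : Fin (n.len + 1)) (hij : i ≤ j) (hjk : j ≤ k), (arSquare A hij hjk).IsPushout)

variable {n : SimplexCategory}

lemma sObj_le_sObjIso : W.sObj n ≤ W.sObjIso n := fun _ hA =>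
  ⟨fun i => by rw [hA.1 i]; exact IsWaldhausen.isZero_pt, hA.2⟩

lemma sObjIso_le_sObj' : W.sObjIso n ≤ W.sObj' n := fun _ hA =>
  ⟨fun i f => IsWaldhausen.weq_of_isIso _ (isIso_of_isZero IsWaldhausen.isZero_pt (hA.1 i) f),
    fun i j k hij hjk => W.weakCof_of_cof _ (hA.2.1 i j k hij hjk),
    fun i j k hij hjk => ⟨_, hA.2.2 i j k hij hjk,
      Or.inl ⟨hA.2.1 i j k hij hjk, hA.2.1 j j k le_rfl hjk⟩, Relation.EqvGen.refl _⟩⟩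

lemma sObj_of_iso {A B : Ar n ⥤ C} (hA : W.sObjIso n A) (e : A ≅ B)
    (hB : ∀ i : Fin (n.len + 1), arObj B (le_refl i) = W.pt) : W.sObj n B :=
  ⟨hB, fun i j k hij hjk => (cof_iff_of_iso (e.app _) (e.app _) (e.hom.naturality _)).1
      (hA.2.1 i j k hij hjk),
    fun i j k hij hjk => IsPushout.of_iso (hA.2.2 i j k hij hjk) (e.app _) (e.app _) (e.app _)
      (e.app _)
      (e.hom.naturality _) (e.hom.naturality _) (e.hom.naturality _) (e.hom.naturality _)⟩

variable (W) in
open Classical in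
/-- The diagram `A` with the diagonal entries `A_{i,i}`, assumed to be zero objects, replaced by
the distinguished zero object. -/
noncomputable def strictify (A : Ar n ⥤ C)
    (hA : ∀ i : Fin (n.len + 1), IsZero (arObj A (le_refl i))) :
    Ar n ⥤ C :=
  A.copyObj (fun x => if x.1.1 = x.1.2 then W.pt else A.obj x) fun x =>
    if h : x.1.1 = x.1.2 then
      ((show IsZero (A.obj x) by
        obtain ⟨⟨i, j⟩, hij⟩ := x
        obtain rfl : i = j := h
        exact hA i).iso (IsWaldhausen.isZero_pt (W := W))) ≪≫ eqToIso (by simp [h])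
    else eqToIso (by simp [h])

variable (W) in
/-- The isomorphism between `A` and its strictification. -/
noncomputable def strictifyIso (A : Ar n ⥤ C)
    (hA : ∀ i : Fin (n.len + 1), IsZero (arObj A (le_refl i))) : A ≅ strictify W A hA :=
  A.isoCopyObj _ _

lemma sObj_strictify {A : Ar n ⥤ C} (hA : W.sObjIso n A) :
    W.sObj n (strictify W A hA.1) :=
  sObj_of_iso hA (strictifyIso W A hA.1) fun i => by simp [strictify, arObj]

/-- The pointwise pushout has zero objects on the diagonal, so it belongs to `S_n C` only after
strictification. -/
lemma sObj_closedUnderPushouts : ClosedUnderPushouts W n W.cof (W.sObj n) := by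
  intro A B X P f g inl inr h hf hA hB hX
  have hP : W.sObjIso n P := by
    refine ⟨fun i => ?_, fun i j k hij hjk =>
      cofClass_cof.arHom_of_isPushout h hf hij hjk (hX.2.1 i j k hij hjk),
      fun i j k hij hjk => ?_⟩
    · have := isIso_of_isZero ((sObj_le_sObjIso _ hA).1 i) ((sObj_le_sObjIso _ hX).1 i)
        (g.app ⟨(i, i), le_rfl⟩)
      have := (h ⟨(i, i), le_rfl⟩).isIso_inl_of_isIso
      exact ((sObj_le_sObjIso _ hB).1 i).of_iso (asIso (inl.app ⟨(i, i), le_rfl⟩)).symm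
    · exact isPushout_of_isPushout_corners (φ := arSquareMap f hij hjk) (ψ := arSquareMap g hij hjk)
        (β := arSquareMap inl hij hjk) (η := arSquareMap inr hij hjk) (h _) (h _) (h _)
        (hA.2.2 i j k hij hjk) (hB.2.2 i j k hij hjk) (hX.2.2 i j k hij hjk)
  exact ⟨_, sObj_strictify hP, ⟨strictifyIso W P hP.1⟩⟩

/-- The entries on the diagonal are treated by the gluing lemma, the horizontal maps by
`CofClass.arHom_of_isPushout`, and the squares by `isHomotopyCocartesian_of_isPushout_corners`. -/
lemma sObj'_closedUnderPushouts [W.weq.HasTwoOutOfThreeProperty] (D : W.Factorization) :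
    ClosedUnderPushouts W n W.weakCof (W.sObj' n) := by
  intro A B X P f g inl inr h hf hA hB hX
  have hf' := arCof_iff.1 hf
  refine ⟨P, ⟨fun i p => ?_, fun i j k hij hjk =>
    (cofClass_weakCof D).arHom_of_isPushout h hf hij hjk (hX.2.1 i j k hij hjk),
    fun i j k hij hjk => ?_⟩, ⟨Iso.refl _⟩⟩
  · have hpt := IsWaldhausen.isZero_pt (W := W)
    exact IsWaldhausen.gluing (hpt.to_ _) (hpt.to_ _) (hpt.to_ _) p
      (IsPushout.of_id_fst (f := 𝟙 W.pt)) (h ⟨(i, i), le_rfl⟩)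
      (IsWaldhausen.cof_of_isIso _ inferInstance) (hf'.1 i i le_rfl) (hpt.eq_of_src _ _)
      (hpt.eq_of_src _ _) (hpt.eq_of_src _ _) (hpt.eq_of_src _ _) (hA.1 i _) (hB.1 i _) (hX.1 i _)
  · have good : ∀ {Y : Ar n ⥤ C}, W.sObj' n Y → D.IsGood (arSquare Y hij hjk) := fun hY =>
      D.isGood_of_isHomotopyCocartesian (hY.2.2 i j k hij hjk) (hY.2.1 i j k hij hjk)
    obtain ⟨M, mB, mA, hM⟩ :=
      exists_isPushout (hf'.1 i j hij) (arHom A hij (hij.trans hjk) le_rfl hjk)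
    obtain ⟨a, ha₁, ha₂⟩ : ∃ a : M ⟶ arObj B (hij.trans hjk),
        mB ≫ a = arHom B hij (hij.trans hjk) le_rfl hjk ∧ mA ≫ a = arApp f (hij.trans hjk) :=
      ⟨hM.desc _ _ (f.naturality _).symm, hM.inl_desc _ _ _, hM.inr_desc _ _ _⟩
    exact isHomotopyCocartesian_of_isPushout_corners D (φ := arSquareMap f hij hjk)
      (ψ := arSquareMap g hij hjk) (β := arSquareMap inl hij hjk) (η := arSquareMap inr hij hjk)
      (h _) (h _) (h _) (h _) (hf'.1 _ _ _) (hf'.1 _ _ _) (hf'.1 _ _ _) (hf'.1 _ _ _)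
      (good hA) (good hB) (good hX) (M := M) (inl := mA) (inr := mB) hM.flip (n := a) ha₂ ha₁
      (hf'.2 i j k hij hjk M mA mB a hM.flip ha₂ ha₁)

instance sWald_isWaldhausen (n : SimplexCategory) : (W.sWald n).IsWaldhausen :=
  ClosedUnderPushouts.isWaldhausen sObj_closedUnderPushouts cofClass_cof (fun _ hA => hA.2.1) _
    (fun _ => IsWaldhausen.isZero_pt) rfl rfl

lemma sWald'_isWaldhausen [W.weq.HasTwoOutOfThreeProperty] (D : W.Factorization)
    (n : SimplexCategory) : (W.sWald' n).IsWaldhausen :=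
  ClosedUnderPushouts.isWaldhausen (sObj'_closedUnderPushouts D) (cofClass_weakCof D)
    (fun _ hA => hA.2.1) _
    (fun _ => IsWaldhausen.isZero_pt) rfl rfl

lemma arCof_restrict {m : SimplexCategory} {P Q : MorphismProperty C} (α : m ⟶ n)
    {A B : Ar n ⥤ C} {τ : A ⟶ B} (hτ : arCof P Q n τ) :
    arCof P Q m (Functor.whiskerLeft (arMap α) τ) :=
  ⟨fun _ _ hij => hτ.1 _ _ (α.toOrderHom.monotone hij),
    fun _ _ _ hij hjk => hτ.2 _ _ _ (α.toOrderHom.monotone hij) (α.toOrderHom.monotone hjk)⟩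

theorem S_isSimplicialWaldhausen : W.S.IsSimplicialWaldhausen where
  isWaldhausen n := W.sWald_isWaldhausen n.unop
  isExact {_ n} α :=
    { map_pt := (sWald_isWaldhausen n.unop).isZero_pt
      map_weq := W.S.map_weq α
      map_cof _ hf := arCof_restrict α.unop hf
      map_isPushout h hf := IsPushout.of_map (W.sObj n.unop).ι
        (ObjectProperty.hom_ext _ (NatTrans.ext (funext fun x =>
          (ClosedUnderPushouts.isPushout_app sObj_closedUnderPushouts h hf
            ((arMap α.unop).obj x)).w)))
        (IsPushout.of_forall_isPushout_app fun x =>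
          ClosedUnderPushouts.isPushout_app sObj_closedUnderPushouts h hf
            ((arMap α.unop).obj x)) }

theorem S'_isSimplicialWaldhausen [W.weq.HasTwoOutOfThreeProperty] (D : W.Factorization) :
    W.S'.IsSimplicialWaldhausen where
  isWaldhausen n := sWald'_isWaldhausen D n.unop
  isExact {_ n} α :=
    { map_pt := (sWald'_isWaldhausen D n.unop).isZero_pt
      map_weq := W.S'.map_weq α
      map_cof _ hf := arCof_restrict α.unop hf
      map_isPushout h hf := IsPushout.of_map (W.sObj' n.unop).ι
        (ObjectProperty.hom_ext _ (NatTrans.ext (funext fun x =>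
          (ClosedUnderPushouts.isPushout_app (sObj'_closedUnderPushouts D) h hf
            ((arMap α.unop).obj x)).w)))
        (IsPushout.of_forall_isPushout_app fun x =>
          ClosedUnderPushouts.isPushout_app (sObj'_closedUnderPushouts D) h hf
            ((arMap α.unop).obj x)) }

theorem sInclusion_isExact [W.weq.HasTwoOutOfThreeProperty] (D : W.Factorization) :
    W.sInclusion.IsExact := fun n =>
  { map_pt := (sWald'_isWaldhausen D n.unop).isZero_pt
    map_weq := W.sInclusion.map_weq n
    map_cof _ hf := ⟨hf.1, fun i j k hij hjk X inl inr h =>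
      W.weakCof_of_cof _ (hf.2 i j k hij hjk X inl inr h)⟩
    map_isPushout h hf := IsPushout.of_map (W.sObj' n.unop).ι
      (ObjectProperty.hom_ext _ (NatTrans.ext (funext fun x =>
          (ClosedUnderPushouts.isPushout_app sObj_closedUnderPushouts h hf x).w)))
        (IsPushout.of_forall_isPushout_app fun x =>
          ClosedUnderPushouts.isPushout_app sObj_closedUnderPushouts h hf x) }

end PreWaldhausen

namespace PreWaldhausen

variable {C : Type u} [Category.{v} C] {W : PreWaldhausen C}

lemma weq_of_comp_isIso [W.IsWaldhausen] {A B X : C} (f : A ⟶ B) (g : B ⟶ X) [IsIso g]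
    (h : W.weq (f ≫ g)) : W.weq f := by
  have := W.weq.comp_mem _ _ h (IsWaldhausen.weq_of_isIso (inv g) inferInstance)
  rwa [Category.assoc, IsIso.hom_inv_id, Category.comp_id] at this

/-! ### Functorial replacement of sequences of weak w-cofibrations -/

namespace Factorization

variable (D : W.Factorization) {E : Type u₁} [Category.{v₁} E]

/-- The factorization of a natural transformation which is a pointwise weak w-cofibration. -/
def midFunctor {F G : E ⥤ C} (φ : F ⟶ G) (h : ∀ X, W.weakCof (φ.app X)) : E ⥤ C :=
  W.weakCofArrow.lift
    { obj X := Arrow.mk (φ.app X)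
      map f := Arrow.homMk (F.map f) (G.map f) (φ.naturality f) } h ⋙ D.T

/-- The first map of the factorization of a natural transformation. -/
def iFunctor {F G : E ⥤ C} (φ : F ⟶ G) (h : ∀ X, W.weakCof (φ.app X)) : F ⟶ D.midFunctor φ h where
  app X := D.i (h X)
  naturality _ _ f := (D.i_map (h _) (h _) (F.map f) (G.map f) (φ.naturality f).symm).symm

/-- The second map of the factorization of a natural transformation. -/
def pFunctor {F G : E ⥤ C} (φ : F ⟶ G) (h : ∀ X, W.weakCof (φ.app X)) : D.midFunctor φ h ⟶ G where
  app X := D.p (h X)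
  naturality _ _ f := D.map_p (h _) (h _) (F.map f) (G.map f) (φ.naturality f).symm

/-- A functor which is weakly equivalent to the `j`-th term of a sequence of functors. -/
structure Stage (W : PreWaldhausen C) (F : ℕ ⥤ E ⥤ C) (j : ℕ) where
  /-- the functor -/
  X : E ⥤ C
  /-- the weak equivalence -/
  q : X ⟶ F.obj j
  weq_q : ∀ e, W.weq (q.app e)

variable (F : ℕ ⥤ E ⥤ C)
  (hF : ∀ (j : ℕ) (e : E), W.weakCof ((F.map (homOfLE (Nat.le_add_right j 1))).app e))

include hF in
lemma weakCof_stage {j : ℕ} (S : Stage W F j) (e : E) :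
    W.weakCof ((S.q ≫ F.map (homOfLE (Nat.le_add_right j 1))).app e) :=
  (weakCof_iff_of_arrowWeq (S.q.app e) (𝟙 _) (Category.comp_id _) (S.weq_q e) (W.weq.id_mem _)).2
    (hF j e)

variable [W.IsWaldhausen] (h₀ : ∀ (e : E) (f : W.pt ⟶ (F.obj 0).obj e), W.weq f)

/-- The replacement of the `j`-th term, by repeated factorization starting from the zero object. -/
noncomputable def stage : ∀ j, Stage W F j
  | 0 =>
    { X := (Functor.const _).obj W.pt
      q := { app _ := (IsWaldhausen.isZero_pt (W := W)).to_ _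
             naturality _ _ _ := (IsWaldhausen.isZero_pt (W := W)).eq_of_src _ _ }
      weq_q _ := h₀ _ _ }
  | j + 1 =>
    { X := D.midFunctor _ (weakCof_stage F hF (stage j))
      q := D.pFunctor _ (weakCof_stage F hF (stage j))
      weq_q _ := D.weq_p _ }

include D h₀ hF in
/-- A sequence of weak w-cofibrations which begins with a weakly contractible object is weakly
equivalent to a sequence of w-cofibrations, functorially. -/
lemma exists_cof_sequence : ∃ (X : ℕ ⥤ E ⥤ C) (q : X ⟶ F),
    (∀ {i j : ℕ} (a : i ⟶ j) (e : E), W.cof ((X.map a).app e)) ∧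
    ∀ (j : ℕ) (e : E), W.weq ((q.app j).app e) := by
  let S := D.stage F hF h₀
  let ι (j : ℕ) : (S j).X ⟶ (S (j + 1)).X := D.iFunctor _ (weakCof_stage F hF (S j))
  have hι (j : ℕ) (e : E) : W.cof ((ι j).app e) := D.cof_i _
  have hq (j : ℕ) : ι j ≫ (S (j + 1)).q = (S j).q ≫ F.map (homOfLE (Nat.le_add_right j 1)) := by
    ext e
    exact D.fac _
  refine ⟨Functor.ofSequence ι, NatTrans.ofSequence (fun j => (S j).q) (fun j => ?_), ?_,
    fun j e => (S j).weq_q e⟩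
  · rw [Functor.ofSequence_map_homOfLE_succ]
    exact hq j
  · intro i j a e
    obtain ⟨k, rfl⟩ := Nat.exists_eq_add_of_le (leOfHom a)
    induction k with
    | zero =>
      obtain rfl : a = 𝟙 i := Subsingleton.elim _ _
      rw [CategoryTheory.Functor.map_id]
      exact IsWaldhausen.cof_of_isIso _ (inferInstanceAs (IsIso (𝟙 _)))
    | succ k ih =>
      obtain rfl : a = homOfLE (Nat.le_add_right i k) ≫ homOfLE (Nat.le_add_right (i + k) 1) :=
        Subsingleton.elim _ _
      rw [Functor.map_comp, NatTrans.comp_app, Functor.ofSequence_map_homOfLE_succ]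
      exact IsWaldhausen.cof_comp _ _ (ih _) (hι _ _)

include D in
/-- The version of `exists_cof_sequence` for finite sequences. -/
lemma exists_cof_finSequence {N : ℕ} (F : Fin (N + 1) ⥤ E ⥤ C)
    (h₀ : ∀ (e : E) (f : W.pt ⟶ (F.obj 0).obj e), W.weq f)
    (hF : ∀ {i j : Fin (N + 1)} (a : i ⟶ j) (e : E), W.weakCof ((F.map a).app e)) :
    ∃ (X : Fin (N + 1) ⥤ E ⥤ C) (q : X ⟶ F),
      (∀ {i j : Fin (N + 1)} (a : i ⟶ j) (e : E), W.cof ((X.map a).app e)) ∧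
      ∀ (j : Fin (N + 1)) (e : E), W.weq ((q.app j).app e) := by
  -- extend the sequence by repeating its last term
  let r (j : ℕ) : Fin (N + 1) := ⟨min j N, by lia⟩
  have hr : Monotone r := fun i j h => by
    change min i N ≤ min j N
    lia
  have hr₀ : r 0 = 0 := Fin.ext (Nat.zero_min N)
  have hrv (i : Fin (N + 1)) : r i.val = i := Fin.ext (min_eq_left (by lia))
  let v : Fin (N + 1) ⥤ ℕ := Monotone.functor (f := fun i => i.val) (fun _ _ h => h)
  obtain ⟨X, q, hX, hq⟩ := D.exists_cof_sequence (hr.functor ⋙ F) (fun _ _ => hF _ _)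
    (fun e f => by
      have : IsIso ((F.map (eqToHom hr₀)).app e) := inferInstance
      exact @weq_of_comp_isIso _ _ _ _ _ _ _ f ((F.map (eqToHom hr₀)).app e) this (h₀ e _))
  refine ⟨v ⋙ X, Functor.whiskerLeft v q ≫
    Functor.whiskerRight (G := v ⋙ hr.functor) (H := 𝟭 _)
      { app i := eqToHom (hrv i), naturality _ _ _ := Subsingleton.elim _ _ } F,
    fun _ _ => hX _ _, fun j e => W.weq.comp_mem _ _ (hq _ _) (IsWaldhausen.weq_of_isIso _ ?_)⟩
  exact inferInstanceAs (IsIso ((F.map (eqToHom (hrv j))).app e))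

end Factorization

/-! ### Diagrams of quotients of a sequence of w-cofibrations -/

section

variable [W.IsWaldhausen] {n : SimplexCategory}

/-- The functor `(i, j) ↦ i` on `Ar[n]`. -/
abbrev arFst (n : SimplexCategory) : Ar n ⥤ Fin (n.len + 1) :=
  Monotone.functor (f := fun x => x.1.1) (fun _ _ h => h.1)

/-- The functor `(i, j) ↦ j` on `Ar[n]`. -/
abbrev arSnd (n : SimplexCategory) : Ar n ⥤ Fin (n.len + 1) :=
  Monotone.functor (f := fun x => x.1.2) (fun _ _ h => h.2)

/-- The natural transformation with components `i ≤ j` on `Ar[n]`. -/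
def arFstSnd (n : SimplexCategory) : arFst n ⟶ arSnd n where
  app x := homOfLE x.2
  naturality _ _ _ := Subsingleton.elim _ _

/-- The functor `j ↦ (0, j)`. -/
abbrev arRow (n : SimplexCategory) : Fin (n.len + 1) ⥤ Ar n :=
  Monotone.functor (f := fun j => (⟨(0, j), Fin.zero_le j⟩ : Ar n)) (fun _ _ h => ⟨le_rfl, h⟩)

/-- The functor `(i, j) ↦ (i, i)`. -/
abbrev arDiag (n : SimplexCategory) : Ar n ⥤ Ar n :=
  Monotone.functor (f := fun x => (⟨(x.1.1, x.1.1), le_rfl⟩ : Ar n)) (fun _ _ h => ⟨h.1, h.1⟩)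

/-- The diagram of quotients `X_j / X_i` of a sequence of w-cofibrations `X`, for any choice `H`
of zero objects, is isomorphic to an object of `S_n C`. -/
lemma sObjIso_of_isPushout {X : Fin (n.len + 1) ⥤ C}
    (hX : ∀ {i j : Fin (n.len + 1)} (a : i ⟶ j), W.cof (X.map a)) {H R : Ar n ⥤ C}
    (hH : ∀ x, IsZero (H.obj x)) {g : arFst n ⋙ X ⟶ H} {inl : arSnd n ⋙ X ⟶ R} {inr : H ⟶ R}
    (h : ∀ x, IsPushout ((Functor.whiskerRight (arFstSnd n) X).app x) (g.app x) (inl.app x)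
      (inr.app x)) : W.sObjIso n R := by
  have row : ∀ (i j k : Fin (n.len + 1)) (hij : i ≤ j) (hjk : j ≤ k),
      IsPushout (X.map (homOfLE hjk)) (inl.app ⟨(i, j), hij⟩) (inl.app ⟨(i, k), hij.trans hjk⟩)
        (arHom R hij (hij.trans hjk) le_rfl hjk) := by
    intro i j k hij hjk
    have := isIso_of_isZero (hH _) (hH _) (arHom H hij (hij.trans hjk) le_rfl hjk)
    have h₁ : IsPushout (X.map (homOfLE hij) ≫ X.map (homOfLE hjk)) (g.app ⟨(i, j), hij⟩)
        (inl.app ⟨(i, k), hij.trans hjk⟩)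
        (inr.app ⟨(i, j), hij⟩ ≫ arHom R hij (hij.trans hjk) le_rfl hjk) := by
      refine (h ⟨(i, k), hij.trans hjk⟩).of_iso (Iso.refl _) (Iso.refl _)
        (asIso (arHom H hij (hij.trans hjk) le_rfl hjk)).symm (Iso.refl _) ?_ ?_ ?_ ?_
      · simp only [Iso.refl_hom, ← X.map_comp]
        exact (Category.comp_id _).trans (Category.id_comp _).symm
      · exact (hH _).eq_of_tgt _ _
      · exact (Category.comp_id _).trans (Category.id_comp _).symm
      · simp only [Iso.refl_hom, Iso.symm_hom, asIso_inv, Category.comp_id]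
        rw [IsIso.eq_inv_comp]
        exact inr.naturality _
    exact IsPushout.of_left h₁ (inl.naturality
      (X := (⟨(i, j), hij⟩ : Ar n)) (Y := ⟨(i, k), hij.trans hjk⟩) (homOfLE ⟨le_rfl, hjk⟩))
      (h ⟨(i, j), hij⟩)
  refine ⟨fun i => ?_, fun i j k hij hjk =>
    IsWaldhausen.cof_cobaseChange (row i j k hij hjk) (hX _),
    fun i j k hij hjk => ?_⟩
  · have : IsIso ((Functor.whiskerRight (arFstSnd n) X).app ⟨(i, i), le_rfl⟩) :=
      inferInstanceAs (IsIso (X.map (𝟙 i)))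
    have := (h ⟨(i, i), le_rfl⟩).isIso_inr_of_isIso
    exact (hH ⟨(i, i), le_rfl⟩).of_iso (asIso (inr.app ⟨(i, i), le_rfl⟩)).symm
  · have e : ∀ (l : Fin (n.len + 1)) (hjl : j ≤ l), inl.app ⟨(i, l), hij.trans hjl⟩ ≫
        arHom R (hij.trans hjl) hjl hij le_rfl = inl.app ⟨(j, l), hjl⟩ := fun l hjl => by
      have := inl.naturality (X := (⟨(i, l), hij.trans hjl⟩ : Ar n)) (Y := ⟨(j, l), hjl⟩)
        (homOfLE ⟨hij, le_rfl⟩)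
      refine this.symm.trans ?_
      exact (congrArg (· ≫ inl.app ⟨(j, l), hjl⟩) (X.map_id l)).trans (Category.id_comp _)
    refine IsPushout.of_top ?_ (arSquare R hij hjk).fac (row i j k hij hjk)
    have := row j j k le_rfl hjk
    rw [← e j le_rfl, ← e k hjk] at this
    exact this

end

end PreWaldhausen

lemma exists_isPushout_app_app {E : Type u₁} [Category.{v₁} E] {J : Type u₂} [Category.{v₂} J]
    {C : Type u} [Category.{v} C] {A B X : E ⥤ J ⥤ C} (f : A ⟶ B) (g : A ⟶ X)
    (h : ∀ e j, HasPushout ((f.app e).app j) ((g.app e).app j)) :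
    ∃ (P : E ⥤ J ⥤ C) (inl : B ⟶ P) (inr : X ⟶ P), IsPushout f g inl inr ∧
      ∀ e j, IsPushout ((f.app e).app j) ((g.app e).app j) ((inl.app e).app j)
        ((inr.app e).app j) := by
  have h' : ∀ e, HasPushout (f.app e) (g.app e) := fun e => by
    obtain ⟨P, inl, inr, hP⟩ := exists_isPushout_app (f.app e) (g.app e) (h e)
    exact (IsPushout.of_forall_isPushout_app hP).hasPushout
  obtain ⟨P, inl, inr, hP⟩ := exists_isPushout_app f g h'
  exact ⟨P, inl, inr, IsPushout.of_forall_isPushout_app hP,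
    fun e j => isPushout_app (hP e) (h e) j⟩

namespace PreWaldhausen

variable {C : Type u} [Category.{v} C] {W : PreWaldhausen C}

/-! ### Rectification of the objects of `S'_n C` -/

variable {n : SimplexCategory}

lemma sObj'_of_levelWeq [W.weq.HasTwoOutOfThreeProperty] {A B : Ar n ⥤ C} (f : A ⟶ B)
    (hf : W.levelWeq n f) (hB : W.sObj' n B) : W.sObj' n A :=
  ⟨fun i p => W.weq.of_postcomp _ _ (hf _) (hB.1 i (p ≫ f.app _)),
    fun i j k hij hjk => (weakCof_iff_of_arrowWeq (f.app _) (f.app _) (f.naturality _) (hf _)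
      (hf _)).2 (hB.2.1 i j k hij hjk),
    fun i j k hij hjk => (isHomotopyCocartesian_iff_of_squareWeq (arSquareMap f hij hjk)
      ⟨hf _, hf _, hf _, hf _⟩).2 (hB.2.2 i j k hij hjk)⟩

variable [W.IsWaldhausen]

/-- The natural transformation with components `(0, i) ≤ (i, i)`. -/
def arRowFst (n : SimplexCategory) : arFst n ⋙ arRow n ⟶ arDiag n where
  app x := homOfLE (show (⟨(0, x.1.1), _⟩ : Ar n) ≤ ⟨(x.1.1, x.1.1), _⟩ from
    ⟨Fin.zero_le _, le_rfl⟩)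
  naturality _ _ _ := Subsingleton.elim _ _

/-- The natural transformation with components `(0, j) ≤ (i, j)`. -/
def arRowSnd (n : SimplexCategory) : arSnd n ⋙ arRow n ⟶ 𝟭 (Ar n) where
  app x := homOfLE (show (⟨(0, x.1.2), _⟩ : Ar n) ≤ x from ⟨Fin.zero_le _, le_rfl⟩)
  naturality _ _ _ := Subsingleton.elim _ _

/-- The natural transformation with components `(i, i) ≤ (i, j)`. -/
def arDiagTo (n : SimplexCategory) : arDiag n ⟶ 𝟭 (Ar n) where
  app x := homOfLE (show (⟨(x.1.1, x.1.1), _⟩ : Ar n) ≤ x from ⟨le_rfl, x.2⟩)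
  naturality _ _ _ := Subsingleton.elim _ _

/-- Every object `A` of `S'_n C` is connected to an object of `S_n C` up to isomorphism by a
natural zigzag of weak equivalences.  The first row of `A` is replaced by a sequence of
w-cofibrations `X_0 ⟶ ⋯ ⟶ X_n`, and the zigzag is
`A_{i,j} ⟵ X_j ∪_{X_i} A_{i,i} ⟶ X_j ∪_{X_i} *`. -/
theorem exists_rectification [W.weq.HasTwoOutOfThreeProperty] (D : W.Factorization)
    (n : SimplexCategory) :
    ∃ (Ψ Φ : (W.sObj' n).FullSubcategory ⥤ Ar n ⥤ C) (α : Ψ ⟶ (W.sObj' n).ι) (β : Ψ ⟶ Φ),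
      (∀ A, W.levelWeq n (α.app A)) ∧ (∀ A, W.levelWeq n (β.app A)) ∧
      (∀ A, W.sObjIso n (Φ.obj A)) ∧ ∀ A, W.sObjIso n A.obj → W.sObjIso n (Ψ.obj A) := by
  let ι := (W.sObj' n).ι
  let wl {J K : Type} [Category.{0} J] [Category.{0} K] := Functor.whiskeringLeft J K C
  have hpt := IsWaldhausen.isZero_pt (W := W)
  obtain ⟨X, q, hX, hq⟩ := D.exists_cof_finSequence
    (arRow n ⋙ evaluation (Ar n) C ⋙ (Functor.whiskeringLeft _ _ C).obj ι)
    (fun A f => A.property.1 0 f)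
    (fun {i j} a A => A.property.2.1 0 i j (Fin.zero_le _) (leOfHom a))
  let f : X.flip ⋙ (wl).obj (arFst n) ⟶ X.flip ⋙ (wl).obj (arSnd n) :=
    Functor.whiskerLeft X.flip ((wl).map (arFstSnd n))
  let q' : X.flip ⟶ ι ⋙ (wl).obj (arRow n) :=
    { app A :=
        { app j := (q.app j).app A
          naturality i j a := congrArg (fun t => t.app A) (q.naturality a) }
      naturality A B a := by
        ext j
        exact (q.app j).naturality a }
  -- the maps `X_i ⟶ A_{0,i} ⟶ A_{i,i}` and `X_j ⟶ A_{0,j} ⟶ A_{i,j}`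
  let g : X.flip ⋙ (wl).obj (arFst n) ⟶ ι ⋙ (wl).obj (arDiag n) :=
    Functor.whiskerRight q' ((wl).obj (arFst n)) ≫
      Functor.whiskerLeft ι ((wl).map (arRowFst n))
  let l : X.flip ⋙ (wl).obj (arSnd n) ⟶ ι :=
    Functor.whiskerRight q' ((wl).obj (arSnd n)) ≫
      Functor.whiskerLeft ι ((wl).map (arRowSnd n))
  let d : ι ⋙ (wl).obj (arDiag n) ⟶ ι :=
    Functor.whiskerLeft ι ((wl).map (arDiagTo n))
  let z : ι ⋙ (wl).obj (arDiag n) ⟶ (Functor.const _).obj ((Functor.const _).obj W.pt) :=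
    { app A :=
        { app x := hpt.from_ _
          naturality _ _ _ := hpt.eq_of_tgt _ _ }
      naturality _ _ _ := by
        ext x
        exact hpt.eq_of_tgt _ _ }
  have hf (A) (x : Ar n) : W.cof ((f.app A).app x) := hX _ _
  obtain ⟨Ψ, inl, inr, hΨ, hΨ'⟩ := exists_isPushout_app_app f g
    fun A x => IsWaldhausen.hasPushout _ _ (hf A x)
  obtain ⟨Φ, inl', inr', hΦ, hΦ'⟩ := exists_isPushout_app_app f (g ≫ z)
    fun A x => IsWaldhausen.hasPushout _ _ (hf A x)
  have hq' (A) (x : Ar n) : (f.app A).app x ≫ (q.app x.1.2).app A =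
      (q.app x.1.1).app A ≫ arHom A.obj (Fin.zero_le x.1.1) (Fin.zero_le x.1.2) le_rfl x.2 :=
    congrArg (fun t => t.app A) (q.naturality (homOfLE x.2))
  have hg (A) (x : Ar n) : (g.app A).app x =
      (q.app x.1.1).app A ≫ arHom A.obj (Fin.zero_le x.1.1) le_rfl (Fin.zero_le _) le_rfl := rfl
  have hl (A) (x : Ar n) : (l.app A).app x =
      (q.app x.1.2).app A ≫ arHom A.obj (Fin.zero_le x.1.2) x.2 (Fin.zero_le _) le_rfl := rfl
  have hw : f ≫ l = g ≫ d := by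
    ext A x
    change (f.app A).app x ≫ (l.app A).app x = (g.app A).app x ≫
      arHom A.obj le_rfl x.2 le_rfl x.2
    have aux : ∀ {a b b' c c' e : C} {s : a ⟶ b} {t : b ⟶ c} {s' : a ⟶ b'} {u : b' ⟶ c}
        {k : c ⟶ e} {u' : b' ⟶ c'} {k' : c' ⟶ e}, s ≫ t = s' ≫ u → u ≫ k = u' ≫ k' →
        s ≫ t ≫ k = (s' ≫ u') ≫ k' := by
      intro _ _ _ _ _ _ _ _ _ _ _ _ _ h h'
      rw [reassoc_of% h, h', Category.assoc]
    exact aux (hq' A x) (arSquare A.obj (Fin.zero_le x.1.1) x.2).fac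
  let α : Ψ ⟶ ι := hΨ.desc l d hw
  have hα₁ (A) (x : Ar n) : (inl.app A).app x ≫ (α.app A).app x = (l.app A).app x :=
    congrArg (fun t => (t.app A).app x) (hΨ.inl_desc l d hw)
  have hα₂ (A) (x : Ar n) : (inr.app A).app x ≫ (α.app A).app x = (d.app A).app x :=
    congrArg (fun t => (t.app A).app x) (hΨ.inr_desc l d hw)
  have hw' : f ≫ inl' = g ≫ z ≫ inr' := by rw [hΦ.w, Category.assoc]
  let β : Ψ ⟶ Φ := hΨ.desc inl' (z ≫ inr') hw'
  have hβ₁ (A) (x : Ar n) : (inl.app A).app x ≫ (β.app A).app x = (inl'.app A).app x :=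
    congrArg (fun t => (t.app A).app x) (hΨ.inl_desc inl' (z ≫ inr') hw')
  have hβ₂ (A) (x : Ar n) : (inr.app A).app x ≫ (β.app A).app x =
      (z.app A).app x ≫ (inr'.app A).app x :=
    congrArg (fun t => (t.app A).app x) (hΨ.inr_desc inl' (z ≫ inr') hw')
  refine ⟨Ψ, Φ, α, β, fun A x => ?_, fun A x => ?_, fun A => ?_, fun A hA => ?_⟩
  · -- compare the homotopy cocartesian squares which define `Ψ A` and those of `A`
    let sq : Square C := ⟨(f.app A).app x, (g.app A).app x, (inl.app A).app x, (inr.app A).app x,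
      (hΨ' A x).w⟩
    let φ : sq ⟶ arSquare A.obj (Fin.zero_le x.1.1) x.2 :=
      { τ₁ := (q.app x.1.1).app A
        τ₂ := (q.app x.1.2).app A
        τ₃ := 𝟙 _
        τ₄ := (α.app A).app x
        comm₁₂ := hq' A x
        comm₁₃ := Category.comp_id _
        comm₂₄ := hα₁ A x
        comm₃₄ := (hα₂ A x).trans (Category.id_comp _).symm }
    exact D.weq_of_isGood φ (hq _ _) (hq _ _) (W.weq.id_mem _)
      (D.isGood_of_isPushout (hΨ' A x) (W.weakCof_of_cof _ (hf A x)) (Or.inl (hf A x)))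
      (D.isGood_of_isHomotopyCocartesian (A.property.2.2 _ _ _ _ x.2) (A.property.2.1 _ _ _ _ x.2))
  · have hz : W.weq ((z.app A).app x) := by
      refine W.weq.of_precomp (hpt.to_ _) _ (A.property.1 x.1.1 _) ?_
      exact IsWaldhausen.weq_of_isIso _ (isIso_of_isZero hpt hpt _)
    exact IsWaldhausen.gluing (𝟙 _) (𝟙 _) ((z.app A).app x) _ (hΨ' A x) (hΦ' A x) (hf A x) (hf A x)
      ((Category.comp_id _).trans (Category.id_comp _).symm) (Category.id_comp _).symm
      ((hβ₁ A x).trans (Category.id_comp _).symm) (hβ₂ A x) (W.weq.id_mem _) (W.weq.id_mem _) hz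
  · exact sObjIso_of_isPushout (X := X.flip.obj A) (fun _ => hX _ _) (fun _ => hpt) (hΦ' A)
  · exact sObjIso_of_isPushout (X := X.flip.obj A) (fun _ => hX _ _) (fun x => hA.1 x.1.1) (hΨ' A)

open SSet

lemma anodyne_sObjIso_le_sObj' [W.weq.HasTwoOutOfThreeProperty] (D : W.Factorization)
    (n : SimplexCategory) :
    anodyneExtensions (nerveMap (weqInclusion (sObjIso_le_sObj' (W := W) (n := n))
      (W.levelWeq n))) := by
  obtain ⟨Ψ, Φ, α, β, hα, hβ, hΦ, hΨ⟩ := exists_rectification D n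
  have hΨ' : ∀ {A B : (W.sObj' n).FullSubcategory} (f : A ⟶ B), W.levelWeq n f.hom →
      W.levelWeq n (Ψ.map f) := fun {A B} f hf x => by
    refine W.weq.of_postcomp _ _ (hα B x) ?_
    have e : (Ψ.map f).app x ≫ (α.app B).app x = (α.app A).app x ≫ f.hom.app x :=
      congrArg (fun t => t.app x) (α.naturality f)
    rw [e]
    exact W.weq.comp_mem _ _ (hα A x) (hf x)
  refine anodyne_nerveMap_weqInclusion _ _ Ψ Φ α β hα hβ
    (fun A => sObj'_of_levelWeq _ (hα A) A.property) hΦ hΨ hΨ' fun {A B} f hf x => ?_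
  refine W.weq.of_precomp _ _ (hβ A x) ?_
  have e : (Ψ.map f).app x ≫ (β.app B).app x = (β.app A).app x ≫ (Φ.map f).app x :=
    congrArg (fun t => t.app x) (β.naturality f)
  rw [← e]
  exact W.weq.comp_mem _ _ (hΨ' f hf x) (hβ B x)

lemma anodyne_sObj_le_sObjIso (n : SimplexCategory) :
    anodyneExtensions (nerveMap (weqInclusion (sObj_le_sObjIso (W := W) (n := n))
      (W.levelWeq n))) := by
  let e (A : (W.sObjIso n).FullSubcategory) := strictifyIso W A.obj A.property.1
  let Φ : (W.sObjIso n).FullSubcategory ⥤ Ar n ⥤ C := (W.sObjIso n).ι.copyObj _ e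
  let β : (W.sObjIso n).ι ≅ Φ := (W.sObjIso n).ι.isoCopyObj _ e
  refine anodyne_nerveMap_weqInclusion _ _ (W.sObjIso n).ι Φ (𝟙 _) β.hom
    (fun A => (W.levelWeq n).id_mem _) (fun A x => IsWaldhausen.weq_of_isIso _ ?_)
    (fun A => A.property) (fun A => sObj_strictify A.property) (fun _ h => h) (fun _ hf => hf)
    (fun {A B} f hf x => ?_)
  · exact inferInstanceAs (IsIso ((e A).hom.app x))
  · exact W.weq.comp_mem _ _
      (IsWaldhausen.weq_of_isIso _ (inferInstanceAs (IsIso ((e A).inv.app x))))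
      (W.weq.comp_mem _ _ (hf x)
        (IsWaldhausen.weq_of_isIso _ (inferInstanceAs (IsIso ((e B).hom.app x)))))

theorem sInclusion_wNerve_isWeakEquivalence [W.weq.HasTwoOutOfThreeProperty] (D : W.Factorization) :
    IsBisimplicialWeakEquivalence W.sInclusion.wNerve := by
  refine isWeakEquivalence_of_anodyne (anodyne_diagonalMap _ (fun n => ?_) fun n => ?_)
  · exact mono_nerveMap (weqInclusion (W.sObj_le_sObj' n.unop) (W.levelWeq n.unop))
      (weqInclusion_obj_injective _ _)
  · exact anodyneExtensions.comp_mem _ _ (anodyne_sObj_le_sObjIso (W := W) n.unop)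
      (anodyne_sObjIso_le_sObj' D n.unop)

end PreWaldhausen

end WaldhausenK

theorem mainTheorem7 {C : Type u} [Category.{v} C]
    (W : WaldhausenK.PreWaldhausen C) [W.IsWaldhausen]
    (hsat : W.IsSaturated) (hffwc : W.FFWC) :
    W.S.IsSimplicialWaldhausen ∧ W.S'.IsSimplicialWaldhausen ∧
    W.sInclusion.IsExact ∧
    WaldhausenK.IsBisimplicialWeakEquivalence W.sInclusion.wNerve := by
  have : W.weq.HasTwoOutOfThreeProperty := hsat
  obtain ⟨T, i, p, h⟩ := hffwc
  let D : W.Factorization := ⟨T, i, p, h⟩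
  exact ⟨WaldhausenK.PreWaldhausen.S_isSimplicialWaldhausen,
    WaldhausenK.PreWaldhausen.S'_isSimplicialWaldhausen D,
    WaldhausenK.PreWaldhausen.sInclusion_isExact D,
    WaldhausenK.PreWaldhausen.sInclusion_wNerve_isWeakEquivalence D⟩
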